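/- Let $I^2=[0,1]\times[0,1]\subset\mathbb{R}^2$, and let $C_+(I^2,\mathbb{R})$ be the space of all continuous functions $\rho:I^2\to\mathbb{R}$ with $\rho(x)>0$ for every $x\in I^2$, with the topology induced by the norm $\|f\|_0=\sup_{x\in I^2}|f(x)|$. For $L\geq 1$, a map $\phi:I^2\to\mathbb{R}^2$ is called $L$-bi-Lipschitz if $\frac1L\|x-y\|\le\|\phi(x)-\phi(y)\|\le L\|x-y\|$ for all $x,y\in I^2$, where $\|\cdot\|$ is the Euclidean norm; such a map is differentiable at Lebesgue-almost every point of $I^2$, and its Jacobian is $Jac(\phi)=\det D\phi$. Given $L>1$, let $\mathcal{C}_L$ be the set of all $\rho\in C_+(I^2,\mathbb{R})$ such that there is no $L$-bi-Lipschitz map $\phi:I^2\to\mathbb{R}^2$ satisfying $Jac(\phi)=\rho$ almost everywhere on $I^2$. Then $\mathcal{C}_L$ is an open and dense subset of $C_+(I^2,\mathbb{R})$. -/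

import Mathlib

/-- The plane `ℝ²` with its Euclidean norm and Lebesgue measure. -/
abbrev Plane : Type := EuclideanSpace ℝ (Fin 2)

/-- The standard unit square `I² = [0,1] × [0,1]` in the plane. -/
def unitSquare : Set Plane := {x | ∀ i, x i ∈ Set.Icc (0 : ℝ) 1}

theorem isCompact_unitSquare : IsCompact unitSquare := by
  have h : unitSquare = (EuclideanSpace.equiv (Fin 2) ℝ).toHomeomorph ⁻¹'
      (Set.univ.pi fun _ => Set.Icc (0 : ℝ) 1) := by
    ext x
    simp only [unitSquare, Set.mem_ofPred_eq, Set.mem_preimage, Set.mem_univ_pi]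
    exact Iff.rfl
  rw [h, Homeomorph.isCompact_preimage]
  exact isCompact_univ_pi fun _ => isCompact_Icc

/-- Compactness of `I²` is what puts the sup norm on `C(unitSquare, ℝ)`. -/
instance compactSpace_unitSquare : CompactSpace unitSquare := isCompact_iff_compactSpace.mp isCompact_unitSquare

/-- `C₊(I², ℝ)`: the positive continuous functions on `I²`, as a subspace of the Banach space
`C(I², ℝ)` with the sup norm. -/
abbrev PosDensity : Type := {ρ : C(unitSquare, ℝ) // ∀ x, 0 < ρ x}

/-- The restriction of `φ` to `s` is `L`-bi-Lipschitz. -/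
def IsBiLipschitzOn {X Y : Type*} [MetricSpace X] [MetricSpace Y]
    (L : ℝ) (φ : X → Y) (s : Set X) : Prop :=
  ∀ x ∈ s, ∀ y ∈ s, (1 / L) * dist x y ≤ dist (φ x) (φ y) ∧ dist (φ x) (φ y) ≤ L * dist x y

/-- `Jac(φ) = ρ` a.e. on `I²`: at almost every point `x` of `I²` the restriction of `φ` to `I²`
is differentiable, and its derivative there has determinant `ρ x`. Only the values of `φ`
on `I²` matter. -/
def JacobianEqAE (φ : Plane → Plane) (ρ : unitSquare → ℝ) : Prop :=
  ∀ᵐ x : Plane ∂MeasureTheory.volume, ∀ hx : x ∈ unitSquare,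
    ∃ φ' : Plane →L[ℝ] Plane, HasFDerivWithinAt φ φ' unitSquare x ∧ φ'.det = ρ ⟨x, hx⟩

/-- `𝒞_L`: the positive continuous densities on `I²` that are not a.e. equal to the Jacobian of
any `L`-bi-Lipschitz map `I² → ℝ²`. -/
def nonRealizable (L : ℝ) : Set PosDensity :=
  {ρ | ¬ ∃ φ : Plane → Plane, IsBiLipschitzOn L φ unitSquare ∧ JacobianEqAE φ ρ.1}

/-! Openness. Jacobian determinants are null Lagrangians: integrated against a smooth test function,
`jacobian u v` can be rewritten with no derivative on `u`, so it passes to limits along bounded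
equi-Lipschitz pointwise convergent sequences (`tendsto_integral_mul_jacobian`). After
normalization, `L`-bi-Lipschitz maps are compact by Arzelà–Ascoli (`exists_subseq_tendsto`). Hence a
limit of realizable densities is realized by a limit map (`Realizes.of_tendsto`), and the realizable
densities form a closed set.

Density. Suppose every continuous density within `c` of `ρ₀` is realizable. Measure a realization by
its largest horizontal stretch, and choose `ρ` in this ball such that every realization stretches
more than `s`, with `s` nearly the supremum of the values that can be forced in this way; every
density in the ball then has a realization with stretch at most some `S` slightly above `s`. By
compactness the stretch beyond `s` must already occur on finitely many horizontal lines, even after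
`ρ` is replaced by `ρ₀` near those lines. This leaves room to add there an oscillation `c cos(2πn
x₀)`. Take realizations with stretch at most `S` of the oscillating densities. Their limit realizes
the unperturbed density, so it stretches some segment of a line by more than `s` in a direction `e`.
Thus near the segment the horizontal derivatives are close to the constant vector `S e` in the mean,
and the Jacobian is close to `S e × ∂₁φ`. The latter does not correlate with `cos(2πn x₀)` in the
limit, as the cosine is independent of the second variable. But the density has correlation of order
`c` with it, a contradiction (`oscillation_estimate`, `exists_not_realizes`). -/

open MeasureTheory Filter Topology Set
open scoped NNReal ContDiff

/-! ### Integration by parts for Lipschitz functions. -/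

/-- A Lipschitz function times a compactly supported Lipschitz function is Lipschitz. -/
theorem LipschitzWith.exists_mul_hasCompactSupport {E : Type*} [NormedAddCommGroup E]
    {η u : E → ℝ} {A C : ℝ≥0} (hη : LipschitzWith A η) (hc : HasCompactSupport η)
    (hu : LipschitzWith C u) : ∃ B : ℝ≥0, LipschitzWith B fun x => η x * u x := by
  obtain ⟨M, hM⟩ := hc.exists_bound_of_continuous hη.continuous
  obtain ⟨N, hN⟩ := IsCompact.exists_bound_of_continuousOn hc hu.continuous.continuousOn
  have hM0 : 0 ≤ M := (norm_nonneg _).trans (hM 0)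
  -- Since `u` may be unbounded, it is evaluated alone only at a point of the support of `η`;
  -- symmetry in the two points then covers all cases.
  have key : ∀ x y, x ∈ tsupport η →
      |η x * u x - η y * u y| ≤ (|N| * A + M * C) * dist x y := by
    intro x y hx
    have h1 : |η x - η y| ≤ A * dist x y := by simpa [Real.dist_eq] using hη.dist_le_mul x y
    have h2 : |u x - u y| ≤ C * dist x y := by simpa [Real.dist_eq] using hu.dist_le_mul x y
    have h3 : |u x| ≤ |N| := (hN x hx).trans (le_abs_self _)
    have h4 : |η y| ≤ M := hM y
    calc |η x * u x - η y * u y| = |(η x - η y) * u x + η y * (u x - u y)| := by ring_nf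
      _ ≤ |η x - η y| * |u x| + |η y| * |u x - u y| := by
          rw [← abs_mul, ← abs_mul]; exact abs_add_le _ _
      _ ≤ (A * dist x y) * |N| + M * (C * dist x y) := by gcongr
      _ = _ := by ring
  refine ⟨(|N| * A + M * C).toNNReal, LipschitzWith.of_dist_le_mul fun x y => ?_⟩
  rw [Real.coe_toNNReal _ (by positivity), Real.dist_eq]
  by_cases hx : x ∈ tsupport η
  · exact key x y hx
  by_cases hy : y ∈ tsupport η
  · rw [abs_sub_comm, dist_comm]; exact key y x hy
  · rw [image_eq_zero_of_notMem_tsupport hx, image_eq_zero_of_notMem_tsupport hy]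
    simp only [zero_mul, sub_zero, abs_zero]
    positivity

theorem lineDeriv_eq_zero_of_notMem_tsupport {E : Type*} [NormedAddCommGroup E] [NormedSpace ℝ E]
    {u : E → ℝ} {x : E} (hx : x ∉ tsupport u) (a : E) : lineDeriv ℝ u x a = 0 := by
  have h : u =ᶠ[𝓝 x] fun _ => (0 : ℝ) := notMem_tsupport_iff_eventuallyEq.mp hx
  rw [h.lineDeriv_eq]
  simp [lineDeriv]

theorem LipschitzWith.integrable_mul_lineDeriv {E : Type*} [NormedAddCommGroup E] [NormedSpace ℝ E]
    [MeasurableSpace E] [BorelSpace E] [SecondCountableTopology E] [LocallyCompactSpace E] {μ : Measure E}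
    {w u : E → ℝ} {C : ℝ≥0} (hw : Integrable w μ)
    (hu : LipschitzWith C u) (a : E) : Integrable (fun x => w x * lineDeriv ℝ u x a) μ :=
  hw.mul_bdd (c := C * ‖a‖) (aestronglyMeasurable_lineDeriv hu.continuous μ)
    (.of_forall fun _ => norm_lineDeriv_le_of_lipschitz ℝ hu)

theorem tendsto_integral_mul_of_pointwise {E : Type*} [TopologicalSpace E]
    [MeasurableSpace E] [BorelSpace E] {μ : Measure E} {h : E → ℝ} (hh : Integrable h μ) {v : ℕ → E → ℝ}
    {v' : E → ℝ} {M : ℝ} (hc : ∀ n, Continuous (v n)) (hM : ∀ n x, |v n x| ≤ M)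
    (hv : ∀ x, Tendsto (fun n => v n x) atTop (𝓝 (v' x))) :
    Tendsto (fun n => ∫ x, h x * v n x ∂μ) atTop (𝓝 (∫ x, h x * v' x ∂μ)) := by
  refine tendsto_integral_of_dominated_convergence (fun x => ‖h x‖ * M)
    (fun n => hh.aestronglyMeasurable.mul (hc n).aestronglyMeasurable) (hh.norm.mul_const M)
    (fun n => .of_forall fun x => ?_) (.of_forall fun x => (hv x).const_mul _)
  rw [norm_mul]
  exact mul_le_mul_of_nonneg_left (hM n x) (norm_nonneg _)

section LineDeriv

variable {E : Type*} [NormedAddCommGroup E] [NormedSpace ℝ E] [FiniteDimensional ℝ E]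
  [MeasurableSpace E] [BorelSpace E] {μ : Measure E} [μ.IsAddHaarMeasure]

theorem LipschitzWith.integrable_lineDeriv {u : E → ℝ} {C : ℝ≥0} (hu : LipschitzWith C u)
    (hc : HasCompactSupport u) (a : E) : Integrable (fun x => lineDeriv ℝ u x a) μ := by
  have hs : Function.support (fun x => lineDeriv ℝ u x a) ⊆ tsupport u := by
    intro x hx
    by_contra h
    apply hx
    exact lineDeriv_eq_zero_of_notMem_tsupport h a
  rw [← integrableOn_iff_integrable_of_support_subset hs]
  exact (hu.locallyIntegrable_lineDeriv a).integrableOn_isCompact hc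

theorem LipschitzWith.integral_mul_lineDeriv_eq {w u : E → ℝ} {B C : ℝ≥0}
    (hw : LipschitzWith B w) (hc : HasCompactSupport w) (hu : LipschitzWith C u) (a : E) :
    ∫ x, w x * lineDeriv ℝ u x a ∂μ = - ∫ x, lineDeriv ℝ w x a * u x ∂μ := by
  have := hu.integral_lineDeriv_mul_eq (μ := μ) hw hc a
  rw [← integral_neg]
  simp only [lineDeriv_neg, neg_mul] at this
  simpa only [mul_comm (w _)] using this

/-- Symmetry of mixed second derivatives, in weak form, for Lipschitz functions. -/
theorem LipschitzWith.integral_lineDeriv_mul_lineDeriv_comm {u v : E → ℝ} {A B : ℝ≥0}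
    (hu : LipschitzWith A u) (hc : HasCompactSupport u) (hv : LipschitzWith B v) (a b : E) :
    ∫ x, lineDeriv ℝ u x a * lineDeriv ℝ v x b ∂μ
      = ∫ x, lineDeriv ℝ u x b * lineDeriv ℝ v x a ∂μ := by
  have hua : ∀ t : ℝ, LipschitzWith A fun x => u (x + t • a) := fun t => by
    simpa [Function.comp_def] using hu.comp (isometry_add_right (t • a)).lipschitz
  have hca : ∀ t : ℝ, HasCompactSupport fun x => u (x + t • a) := fun t =>
    hc.comp_homeomorph (Homeomorph.addRight (t • a))
  -- the difference quotients of `u` satisfy the identity obtained by integrating by parts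
  have h1 : ∀ t : ℝ, ∫ x, (t⁻¹ • (u (x + t • a) - u x)) * lineDeriv ℝ v x b ∂μ
      = - ∫ x, (t⁻¹ • (v (x + t • (-a)) - v x)) * lineDeriv ℝ u x b ∂μ := by
    intro t
    have i1 := (hua t).integral_mul_lineDeriv_eq (μ := μ) (hca t) hv b
    have i2 := hu.integral_mul_lineDeriv_eq (μ := μ) hc hv b
    have e1 : ∀ x, lineDeriv ℝ (fun y => u (y + t • a)) x b = lineDeriv ℝ u (x + t • a) b := by
      intro x
      simp only [lineDeriv]
      congr 1
      ext s
      congr 1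
      abel
    have i3 : ∫ x, lineDeriv ℝ u (x + t • a) b * v x ∂μ
        = ∫ x, lineDeriv ℝ u x b * v (x + t • (-a)) ∂μ := by
      rw [← integral_add_right_eq_self (μ := μ)
        (fun x => lineDeriv ℝ u x b * v (x + t • (-a))) (t • a)]
      simp only [smul_neg, add_neg_cancel_right]
    simp only [e1, i3] at i1
    have j1 := LipschitzWith.integrable_mul_lineDeriv (μ := μ)
      ((hua t).continuous.integrable_of_hasCompactSupport (hca t)) hv b
    have j2 := LipschitzWith.integrable_mul_lineDeriv (μ := μ)
      (hu.continuous.integrable_of_hasCompactSupport hc) hv b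
    have hs : HasCompactSupport fun x => lineDeriv ℝ u x b := by
      refine HasCompactSupport.intro hc fun x hx => ?_
      exact lineDeriv_eq_zero_of_notMem_tsupport hx b
    have hint : ∀ w : E → ℝ, Continuous w → Integrable (fun x => lineDeriv ℝ u x b * w x) μ := by
      intro w hw
      obtain ⟨M, hM⟩ := IsCompact.exists_bound_of_continuousOn hs hw.continuousOn
      refine Integrable.mono' ((hu.integrable_lineDeriv (μ := μ) hc b).norm.const_mul M)
        ((aestronglyMeasurable_lineDeriv hu.continuous μ).mul hw.aestronglyMeasurable)
        (.of_forall fun x => ?_)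
      by_cases hx : x ∈ tsupport fun x => lineDeriv ℝ u x b
      · rw [norm_mul, mul_comm]
        exact mul_le_mul_of_nonneg_right (hM x hx) (norm_nonneg _)
      · rw [image_eq_zero_of_notMem_tsupport hx]
        simp
    have j3 := hint (fun x => v (x + t • (-a))) (hv.continuous.comp (continuous_add_const _))
    have j4 := hint v hv.continuous
    calc ∫ x, (t⁻¹ • (u (x + t • a) - u x)) * lineDeriv ℝ v x b ∂μ
        = t⁻¹ * ((∫ x, u (x + t • a) * lineDeriv ℝ v x b ∂μ)
            - ∫ x, u x * lineDeriv ℝ v x b ∂μ) := by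
          rw [← integral_sub j1 j2, ← integral_const_mul]
          congr 1; ext x; simp only [smul_eq_mul]; ring
      _ = - (t⁻¹ * ((∫ x, lineDeriv ℝ u x b * v (x + t • (-a)) ∂μ)
            - ∫ x, lineDeriv ℝ u x b * v x ∂μ)) := by rw [i1, i2]; ring
      _ = _ := by
          rw [← integral_sub j3 j4, ← integral_const_mul]
          congr 2; ext x; simp only [smul_eq_mul]; ring
  -- Moving the difference quotient onto `v` reverses the direction of translation, hence `-a`; the
  -- two signs cancel at the end.
  have h2 := (hv.integral_inv_smul_sub_mul_tendsto_integral_lineDeriv_mul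
    (hu.integrable_lineDeriv (μ := μ) hc b) (-a)).neg
  simp only [← h1] at h2
  -- the integrands are supported in a fixed compact set
  let K := Metric.cthickening ‖a‖ (tsupport u)
  have hK : IsCompact K := IsCompact.cthickening hc
  have hKm : MeasurableSet K := hK.isClosed.measurableSet
  have hgi : Integrable (K.indicator fun x => lineDeriv ℝ v x b) μ :=
    (integrable_indicator_iff hKm).2
      ((hv.locallyIntegrable_lineDeriv b).integrableOn_isCompact hK)
  have h3 := hu.integral_inv_smul_sub_mul_tendsto_integral_lineDeriv_mul hgi a
  have hK0 : ∀ x ∉ K, ∀ t : ℝ, t ∈ Ioo (0 : ℝ) 1 → u (x + t • a) = 0 ∧ u x = 0 := by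
    intro x hx t ht
    constructor <;> refine image_eq_zero_of_notMem_tsupport fun h => hx ?_
    · refine Metric.mem_cthickening_of_dist_le x _ _ _ h ?_
      rw [dist_eq_norm]
      simp only [sub_add_cancel_left, norm_neg, norm_smul, Real.norm_eq_abs, abs_of_pos ht.1]
      exact mul_le_of_le_one_left (norm_nonneg _) ht.2.le
    · exact Metric.self_subset_cthickening _ h
  have h4 : ∀ᶠ t : ℝ in 𝓝[>] 0,
      ∫ x, (t⁻¹ • (u (x + t • a) - u x)) * K.indicator (fun x => lineDeriv ℝ v x b) x ∂μ
        = ∫ x, (t⁻¹ • (u (x + t • a) - u x)) * lineDeriv ℝ v x b ∂μ := by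
    filter_upwards [Ioo_mem_nhdsGT (zero_lt_one' ℝ)] with t ht
    congr 1
    ext x
    by_cases hx : x ∈ K
    · rw [indicator_of_mem hx]
    · rw [(hK0 x hx t ht).1, (hK0 x hx t ht).2]; simp
  have h5 := tendsto_nhds_unique (h3.congr' h4) h2
  have h6 : ∀ x, lineDeriv ℝ u x a * K.indicator (fun x => lineDeriv ℝ v x b) x
      = lineDeriv ℝ u x a * lineDeriv ℝ v x b := by
    intro x
    by_cases hx : x ∈ K
    · rw [indicator_of_mem hx]
    · have : x ∉ tsupport u := fun h => hx (Metric.self_subset_cthickening _ h)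
      rw [lineDeriv_eq_zero_of_notMem_tsupport this a, zero_mul, zero_mul]
  simp only [h6] at h5
  rw [h5, ← integral_neg]
  congr 1; ext x
  rw [lineDeriv_neg]; ring

theorem LipschitzWith.ae_lineDeriv_mul {η u : E → ℝ} {A C : ℝ≥0}
    (hη : LipschitzWith A η) (hu : LipschitzWith C u) (a : E) :
    ∀ᵐ x ∂μ, lineDeriv ℝ (fun y => η y * u y) x a
      = η x * lineDeriv ℝ u x a + u x * lineDeriv ℝ η x a := by
  filter_upwards [hη.ae_differentiableAt (μ := μ), hu.ae_differentiableAt (μ := μ)] with x h1 h2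
  rw [(h1.fun_mul h2).lineDeriv_eq_fderiv, h1.lineDeriv_eq_fderiv, h2.lineDeriv_eq_fderiv,
    fderiv_fun_mul h1 h2]
  simp

/-- Derivatives of a bounded, equi-Lipschitz, pointwise convergent sequence converge weakly. -/
theorem tendsto_integral_mul_lineDeriv {w : E → ℝ} {B C : ℝ≥0} (hw : LipschitzWith B w)
    (hc : HasCompactSupport w) {v : ℕ → E → ℝ} {v' : E → ℝ} {M : ℝ}
    (hvC : ∀ n, LipschitzWith C (v n)) (hv'C : LipschitzWith C v') (hM : ∀ n x, |v n x| ≤ M)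
    (hv : ∀ x, Tendsto (fun n => v n x) atTop (𝓝 (v' x))) (a : E) :
    Tendsto (fun n => ∫ x, w x * lineDeriv ℝ (v n) x a ∂μ) atTop
      (𝓝 (∫ x, w x * lineDeriv ℝ v' x a ∂μ)) := by
  simp only [hw.integral_mul_lineDeriv_eq hc (hvC _), hw.integral_mul_lineDeriv_eq hc hv'C]
  exact (tendsto_integral_mul_of_pointwise (hw.integrable_lineDeriv hc a)
    (fun n => (hvC n).continuous) hM hv).neg

end LineDeriv

/-! ### The Jacobian determinant and its weak continuity. -/

/-- The Jacobian determinant of the map `(u, v)`, through line derivatives. -/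
noncomputable def jacobian (u v : Plane → ℝ) (x : Plane) : ℝ :=
  lineDeriv ℝ u x (EuclideanSpace.single 0 1) * lineDeriv ℝ v x (EuclideanSpace.single 1 1) -
    lineDeriv ℝ u x (EuclideanSpace.single 1 1) * lineDeriv ℝ v x (EuclideanSpace.single 0 1)

theorem HasFDerivAt.lineDeriv_apply {φ : Plane → Plane} {φ' : Plane →L[ℝ] Plane} {x : Plane}
    (h : HasFDerivAt φ φ' x) (i : Fin 2) (a : Plane) :
    lineDeriv ℝ (fun y => φ y i) x a = φ' a i :=
  (((EuclideanSpace.proj (𝕜 := ℝ) i).hasFDerivAt.comp x h).hasLineDerivAt a).lineDeriv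

theorem HasFDerivAt.jacobian_eq_det {φ : Plane → Plane} {φ' : Plane →L[ℝ] Plane} {x : Plane}
    (h : HasFDerivAt φ φ' x) : jacobian (fun y => φ y 0) (fun y => φ y 1) x = φ'.det := by
  rw [ContinuousLinearMap.det,
    ← LinearMap.det_toMatrix (EuclideanSpace.basisFun (Fin 2) ℝ).toBasis, Matrix.det_fin_two]
  simp [jacobian, h.lineDeriv_apply, LinearMap.toMatrix_apply]

theorem integrable_mul_lineDeriv_mul_lineDeriv {w u v : Plane → ℝ} {B C : ℝ≥0}
    (hw : Integrable w) (hu : LipschitzWith B u) (hv : LipschitzWith C v) (a b : Plane) :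
    Integrable fun x => w x * (lineDeriv ℝ u x a * lineDeriv ℝ v x b) := by
  simpa only [mul_assoc] using LipschitzWith.integrable_mul_lineDeriv
    (LipschitzWith.integrable_mul_lineDeriv hw hu a) hv b

theorem integrable_mul_jacobian {w u v : Plane → ℝ} {B C : ℝ≥0}
    (hw : Integrable w) (hu : LipschitzWith B u) (hv : LipschitzWith C v) :
    Integrable fun x => w x * jacobian u v x := by
  simp only [jacobian, mul_sub]
  exact (integrable_mul_lineDeriv_mul_lineDeriv hw hu hv _ _).sub
    (integrable_mul_lineDeriv_mul_lineDeriv hw hu hv _ _)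

theorem integral_jacobian_eq_zero {u v : Plane → ℝ} {B C : ℝ≥0} (hu : LipschitzWith B u)
    (hc : HasCompactSupport u) (hv : LipschitzWith C v) :
    Integrable (jacobian u v) ∧ ∫ x, jacobian u v x = 0 := by
  have hi : ∀ a b : Plane, Integrable fun x => lineDeriv ℝ u x a * lineDeriv ℝ v x b := fun a b =>
    LipschitzWith.integrable_mul_lineDeriv (hu.integrable_lineDeriv hc a) hv b
  refine ⟨(hi _ _).sub (hi _ _), ?_⟩
  simp only [jacobian]
  rw [integral_sub (hi _ _) (hi _ _), hu.integral_lineDeriv_mul_lineDeriv_comm hc hv, sub_self]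

/-- The Jacobian determinant is a null Lagrangian. -/
theorem integral_mul_jacobian {η u v : Plane → ℝ} {A B C : ℝ≥0} (hη : LipschitzWith A η)
    (hc : HasCompactSupport η) (hu : LipschitzWith B u) (hv : LipschitzWith C v) :
    ∫ x, η x * jacobian u v x = - ∫ x, u x * jacobian η v x := by
  obtain ⟨D, hD⟩ := hη.exists_mul_hasCompactSupport hc hu
  obtain ⟨hi, h0⟩ := integral_jacobian_eq_zero hD hc.mul_right hv
  have hi' := integrable_mul_jacobian (hη.continuous.integrable_of_hasCompactSupport hc) hu hv
  -- The Jacobian is a derivation in its first entry, and `jacobian (η * u) v` has integral zero.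
  have hae : (fun x => u x * jacobian η v x) =ᵐ[volume]
      fun x => jacobian (fun y => η y * u y) v x - η x * jacobian u v x := by
    filter_upwards [hη.ae_lineDeriv_mul hu (EuclideanSpace.single 0 1),
      hη.ae_lineDeriv_mul hu (EuclideanSpace.single 1 1)] with x h1 h2
    simp only [jacobian, h1, h2]
    ring
  rw [integral_congr_ae hae, integral_sub hi hi', h0]
  ring

theorem ContDiff.exists_lipschitzWith_lineDeriv {η : Plane → ℝ} (hη : ContDiff ℝ ∞ η)
    (hc : HasCompactSupport η) (a : Plane) :
    HasCompactSupport (fun x => lineDeriv ℝ η x a) ∧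
      ∃ A : ℝ≥0, LipschitzWith A fun x => lineDeriv ℝ η x a := by
  have h1 : (fun x => lineDeriv ℝ η x a) = fun x => fderiv ℝ η x a := by
    ext x
    exact (hη.differentiable (by simp) x).lineDeriv_eq_fderiv
  have h2 : HasCompactSupport fun x => fderiv ℝ η x a := hc.fderiv_apply ℝ a
  have h3 : ContDiff ℝ ∞ fun x => fderiv ℝ η x a := by
    have := hη.fderiv_right (m := ∞) (by simp)
    exact this.clm_apply contDiff_const
  rw [h1]
  exact ⟨h2, ContDiff.lipschitzWith_of_hasCompactSupport h2 h3 (by simp)⟩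

/-- A strongly convergent factor times a weakly convergent one: `u n` may be replaced by `u'` by
dominated convergence, the derivatives of `v n` being uniformly bounded, and then `h * u'` is a
fixed Lipschitz test function. -/
theorem tendsto_integral_mul_mul_lineDeriv {h : Plane → ℝ} {A C : ℝ≥0} (hA : LipschitzWith A h)
    (hc : HasCompactSupport h) {u v : ℕ → Plane → ℝ} {u' v' : Plane → ℝ} {M : ℝ}
    (huC : ∀ n, LipschitzWith C (u n)) (hu'C : LipschitzWith C u')
    (hvC : ∀ n, LipschitzWith C (v n)) (hv'C : LipschitzWith C v')
    (huM : ∀ n x, |u n x| ≤ M) (hvM : ∀ n x, |v n x| ≤ M)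
    (hu : ∀ x, Tendsto (fun n => u n x) atTop (𝓝 (u' x)))
    (hv : ∀ x, Tendsto (fun n => v n x) atTop (𝓝 (v' x))) (b : Plane) :
    Tendsto (fun n => ∫ x, u n x * (h x * lineDeriv ℝ (v n) x b)) atTop
      (𝓝 (∫ x, u' x * (h x * lineDeriv ℝ v' x b))) := by
  have hhi : Integrable h := hA.continuous.integrable_of_hasCompactSupport hc
  have hint : ∀ (w : Plane → ℝ) (z : Plane → ℝ), Continuous w → (∀ x, |w x| ≤ M) →
      LipschitzWith C z → Integrable fun x => w x * (h x * lineDeriv ℝ z x b) := by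
    intro w z hw hwM hz
    exact (LipschitzWith.integrable_mul_lineDeriv hhi hz b).bdd_mul (c := M)
      hw.aestronglyMeasurable (.of_forall hwM)
  have hu'M : ∀ x, |u' x| ≤ M := fun x =>
    le_of_tendsto (hu x).abs (.of_forall fun n => huM n x)
  obtain ⟨D, hD⟩ := hA.exists_mul_hasCompactSupport hc hu'C
  have h1 := tendsto_integral_mul_lineDeriv hD hc.mul_right hvC hv'C hvM hv b (μ := volume)
  have h2 : Tendsto (fun n => ∫ x, (u n x * (h x * lineDeriv ℝ (v n) x b) -
      u' x * (h x * lineDeriv ℝ (v n) x b))) atTop (𝓝 (∫ _ : Plane, (0 : ℝ))) := by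
    refine tendsto_integral_of_dominated_convergence (fun x => 2 * M * (‖h x‖ * (C * ‖b‖)))
      (fun n => ((hint _ _ (huC n).continuous (huM n) (hvC n)).sub
        (hint _ _ hu'C.continuous hu'M (hvC n))).aestronglyMeasurable)
      ((hhi.norm.mul_const _).const_mul _) (fun n => .of_forall fun x => ?_)
      (.of_forall fun x => ?_)
    · rw [← sub_mul, norm_mul, norm_mul]
      have h3 : ‖u n x - u' x‖ ≤ 2 * M := by
        have := norm_sub_le (u n x) (u' x)
        have := huM n x
        have := hu'M x
        simp only [Real.norm_eq_abs] at *
        linarith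
      have h4 : ‖lineDeriv ℝ (v n) x b‖ ≤ C * ‖b‖ := norm_lineDeriv_le_of_lipschitz ℝ (hvC n)
      have h5 : 0 ≤ M := (abs_nonneg _).trans (hu'M x)
      gcongr
    · have h3 : Tendsto (fun n => |u n x - u' x| * (‖h x‖ * (C * ‖b‖))) atTop (𝓝 0) := by
        have := ((hu x).sub_const (u' x)).abs.mul_const (‖h x‖ * (C * ‖b‖))
        simpa using this
      refine squeeze_zero_norm (fun n => ?_) h3
      have h4 : ‖lineDeriv ℝ (v n) x b‖ ≤ C * ‖b‖ := norm_lineDeriv_le_of_lipschitz ℝ (hvC n)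
      rw [← sub_mul, norm_mul, norm_mul, Real.norm_eq_abs (u n x - u' x)]
      gcongr
  have h3 := h2.add h1
  simp only [integral_zero, zero_add] at h3
  have e : ∀ x, u' x * (h x * lineDeriv ℝ v' x b) = h x * u' x * lineDeriv ℝ v' x b :=
    fun x => by ring
  simp only [e]
  refine h3.congr fun n => ?_
  rw [integral_sub (hint _ _ (huC n).continuous (huM n) (hvC n))
    (hint _ _ hu'C.continuous hu'M (hvC n))]
  have e' : ∀ x, u' x * (h x * lineDeriv ℝ (v n) x b) = h x * u' x * lineDeriv ℝ (v n) x b :=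
    fun x => by ring
  simp only [e']
  ring

/-- Weak continuity of the Jacobian determinant. -/
theorem tendsto_integral_mul_jacobian {η : Plane → ℝ} {C : ℝ≥0} (hη : ContDiff ℝ ∞ η)
    (hc : HasCompactSupport η) {u v : ℕ → Plane → ℝ} {u' v' : Plane → ℝ} {M : ℝ}
    (huC : ∀ n, LipschitzWith C (u n)) (hu'C : LipschitzWith C u')
    (hvC : ∀ n, LipschitzWith C (v n)) (hv'C : LipschitzWith C v')
    (huM : ∀ n x, |u n x| ≤ M) (hvM : ∀ n x, |v n x| ≤ M)
    (hu : ∀ x, Tendsto (fun n => u n x) atTop (𝓝 (u' x)))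
    (hv : ∀ x, Tendsto (fun n => v n x) atTop (𝓝 (v' x))) :
    Tendsto (fun n => ∫ x, η x * jacobian (u n) (v n) x) atTop
      (𝓝 (∫ x, η x * jacobian u' v' x)) := by
  obtain ⟨A, hA⟩ := ContDiff.lipschitzWith_of_hasCompactSupport hc hη (by simp)
  obtain ⟨c0, A0, h0⟩ := hη.exists_lipschitzWith_lineDeriv hc (EuclideanSpace.single 0 1)
  obtain ⟨c1, A1, h1⟩ := hη.exists_lipschitzWith_lineDeriv hc (EuclideanSpace.single 1 1)
  have hint : ∀ (h w z : Plane → ℝ) (b : Plane), Integrable h → Continuous w → (∀ x, |w x| ≤ M) →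
      LipschitzWith C z → Integrable fun x => w x * (h x * lineDeriv ℝ z x b) := by
    intro h w z b hhi hw hwM hz
    exact (LipschitzWith.integrable_mul_lineDeriv hhi hz b).bdd_mul (c := M)
      hw.aestronglyMeasurable (.of_forall hwM)
  have hu'M : ∀ x, |u' x| ≤ M := fun x =>
    le_of_tendsto (hu x).abs (.of_forall fun n => huM n x)
  have i0 := h0.continuous.integrable_of_hasCompactSupport c0 (μ := volume)
  have i1 := h1.continuous.integrable_of_hasCompactSupport c1 (μ := volume)
  have key : ∀ w z : Plane → ℝ, LipschitzWith C w → (∀ x, |w x| ≤ M) → LipschitzWith C z →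
      ∫ x, η x * jacobian w z x =
        -((∫ x, w x * (lineDeriv ℝ η x (EuclideanSpace.single 0 1) *
            lineDeriv ℝ z x (EuclideanSpace.single 1 1)))
          - ∫ x, w x * (lineDeriv ℝ η x (EuclideanSpace.single 1 1) *
            lineDeriv ℝ z x (EuclideanSpace.single 0 1))) := by
    intro w z hw hwM hz
    rw [integral_mul_jacobian hA hc hw hz, ← integral_sub
      (hint _ w z _ i0 hw.continuous hwM hz) (hint _ w z _ i1 hw.continuous hwM hz)]
    simp only [jacobian, mul_sub]
  rw [key u' v' hu'C hu'M hv'C]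
  simp only [fun n => key (u n) (v n) (huC n) (huM n) (hvC n)]
  exact ((tendsto_integral_mul_mul_lineDeriv h0 c0 huC hu'C hvC hv'C huM hvM hu hv _).sub
    (tendsto_integral_mul_mul_lineDeriv h1 c1 huC hu'C hvC hv'C huM hvM hu hv _)).neg

/-! ### Normalized realizations of a density. -/

/-- The nearest point retraction of the plane onto the unit square. -/
noncomputable def clampSquare (x : Plane) : Plane :=
  WithLp.toLp 2 fun i => (projIcc (0 : ℝ) 1 zero_le_one (x i) : ℝ)

theorem clampSquare_mem (x : Plane) : clampSquare x ∈ unitSquare := fun i =>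
  (projIcc (0 : ℝ) 1 zero_le_one (x i)).2

theorem clampSquare_of_mem {x : Plane} (hx : x ∈ unitSquare) : clampSquare x = x := by
  ext i
  simp [clampSquare, projIcc_of_mem zero_le_one (hx i)]

theorem lipschitzWith_clampSquare : LipschitzWith 1 clampSquare := by
  refine LipschitzWith.of_dist_le_mul fun x y => ?_
  simp only [NNReal.coe_one, one_mul, EuclideanSpace.dist_eq]
  refine Real.sqrt_le_sqrt (Finset.sum_le_sum fun i _ => ?_)
  gcongr
  exact (LipschitzWith.projIcc (zero_le_one' ℝ)).dist_le_mul (x i) (y i) |>.trans (by simp)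

theorem zero_mem_unitSquare : (0 : Plane) ∈ unitSquare := fun i => by simp

theorem dist_zero_le_two {x : Plane} (hx : x ∈ unitSquare) : dist x 0 ≤ 2 := by
  rw [EuclideanSpace.dist_eq, Real.sqrt_le_left (by norm_num), Fin.sum_univ_two]
  have h0 := hx 0
  have h1 := hx 1
  simp only [PiLp.zero_apply, Real.dist_eq, sub_zero, sq_abs]
  nlinarith [h0.1, h0.2, h1.1, h1.2]

theorem convex_unitSquare : Convex ℝ unitSquare := by
  intro x hx y hy a b ha hb hab i
  have := convex_Icc (0 : ℝ) 1 (hx i) (hy i) ha hb hab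
  simpa using this

theorem ae_mem_interior_unitSquare :
    ∀ᵐ x : Plane, x ∈ unitSquare → x ∈ interior unitSquare := by
  have h := convex_unitSquare.addHaar_frontier volume
  filter_upwards [measure_eq_zero_iff_ae_notMem.1 h] with x hx hxs
  by_contra hxi
  exact hx ⟨subset_closure hxs, hxi⟩

/-- `φ` is a normalized solution of the prescribed Jacobian problem for the density `ρ`: it is
`L`-bi-Lipschitz on the unit square, fixes the origin, is extended to the plane by the retraction
onto the square, and its Jacobian determinant is `ρ`. -/
structure Realizes (L : ℝ≥0) (φ : Plane → Plane) (ρ : Plane → ℝ) : Prop where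
  biLipschitz : IsBiLipschitzOn L φ unitSquare
  map_clamp : ∀ x, φ (clampSquare x) = φ x
  map_zero : φ 0 = 0
  jacobian_eq : ∀ᵐ x : Plane, x ∈ interior unitSquare →
    jacobian (fun y => φ y 0) (fun y => φ y 1) x = ρ x

theorem lipschitzWith_apply (i : Fin 2) : LipschitzWith 1 fun x : Plane => x i :=
  LipschitzWith.of_dist_le_mul fun x y => by
    simpa [dist_eq_norm] using PiLp.norm_apply_le (x - y) i

namespace Realizes

variable {L : ℝ≥0} {φ : Plane → Plane} {ρ : Plane → ℝ}

theorem lipschitzWith (h : Realizes L φ ρ) : LipschitzWith L φ := by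
  refine LipschitzWith.of_dist_le_mul fun x y => ?_
  rw [← h.map_clamp x, ← h.map_clamp y]
  refine (h.biLipschitz _ (clampSquare_mem x) _ (clampSquare_mem y)).2.trans ?_
  gcongr
  simpa using lipschitzWith_clampSquare.dist_le_mul x y

theorem lipschitzWith_coord (h : Realizes L φ ρ) (i : Fin 2) :
    LipschitzWith L fun x => φ x i := by
  simpa [Function.comp_def] using (lipschitzWith_apply i).comp h.lipschitzWith

theorem norm_le (h : Realizes L φ ρ) (x : Plane) : ‖φ x‖ ≤ L * 2 := by
  rw [← h.map_clamp x, ← dist_zero_right, ← h.map_zero]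
  refine (h.biLipschitz _ (clampSquare_mem x) _ zero_mem_unitSquare).2.trans ?_
  gcongr
  exact dist_zero_le_two (clampSquare_mem x)

theorem abs_coord_le (h : Realizes L φ ρ) (i : Fin 2) (x : Plane) : |φ x i| ≤ L * 2 :=
  (PiLp.norm_apply_le (φ x) i).trans (h.norm_le x)

theorem integral_eq (h : Realizes L φ ρ) {η : Plane → ℝ}
    (hη : tsupport η ⊆ interior unitSquare) :
    ∫ x, η x * jacobian (fun y => φ y 0) (fun y => φ y 1) x = ∫ x, η x * ρ x := by
  refine integral_congr_ae ?_
  filter_upwards [h.jacobian_eq] with x hx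
  by_cases hxs : x ∈ interior unitSquare
  · rw [hx hxs]
  · rw [image_eq_zero_of_notMem_tsupport fun h' => hxs (hη h'), zero_mul, zero_mul]

end Realizes

/-- Composing with the retraction and subtracting `φ 0` changes neither the distances nor the
derivative inside the square. The boundary of the square is null, and Rademacher's theorem supplies
the derivative in the converse direction. -/
theorem exists_realizes_iff {L : ℝ≥0} {ρ : unitSquare → ℝ} {ρ' : Plane → ℝ}
    (hρ : ∀ x (hx : x ∈ unitSquare), ρ' x = ρ ⟨x, hx⟩) :
    (∃ φ : Plane → Plane, IsBiLipschitzOn L φ unitSquare ∧ JacobianEqAE φ ρ) ↔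
      ∃ φ, Realizes L φ ρ' := by
  constructor
  · rintro ⟨φ, hφ, hj⟩
    have hin : ∀ x ∈ unitSquare, φ (clampSquare x) - φ 0 = φ x - φ 0 := fun x hx => by
      rw [clampSquare_of_mem hx]
    refine ⟨fun x => φ (clampSquare x) - φ 0, ?_, fun x => ?_, ?_, ?_⟩
    · intro x hx y hy
      simp only [hin x hx, hin y hy, dist_sub_right]
      exact hφ x hx y hy
    · simp only [clampSquare_of_mem (clampSquare_mem x)]
    · simp only [clampSquare_of_mem zero_mem_unitSquare, sub_self]
    · filter_upwards [hj] with x hx hxi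
      obtain ⟨φ', h1, h2⟩ := hx (interior_subset hxi)
      have h3 : HasFDerivAt φ φ' x := h1.hasFDerivAt (mem_interior_iff_mem_nhds.1 hxi)
      have h4 : HasFDerivAt (fun x => φ (clampSquare x) - φ 0) φ' x := by
        refine (h3.sub_const (φ 0)).congr_of_eventuallyEq ?_
        filter_upwards [mem_interior_iff_mem_nhds.1 hxi] with y hy using hin y hy
      rw [h4.jacobian_eq_det, h2, hρ]
  · rintro ⟨φ, hφ⟩
    refine ⟨φ, hφ.biLipschitz, ?_⟩
    filter_upwards [hφ.jacobian_eq, ae_mem_interior_unitSquare,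
      hφ.lipschitzWith.ae_differentiableAt (μ := volume)] with x h1 h2 h3 hx
    refine ⟨fderiv ℝ φ x, h3.hasFDerivAt.hasFDerivWithinAt, ?_⟩
    rw [← h3.hasFDerivAt.jacobian_eq_det, h1 (h2 hx), hρ]

/-! ### Compactness and openness. -/

/-- Normalized bi-Lipschitz maps are precompact for pointwise convergence. -/
theorem exists_subseq_tendsto {L : ℝ≥0} {φ : ℕ → Plane → Plane} {ρ : ℕ → Plane → ℝ}
    (hφ : ∀ n, Realizes L (φ n) (ρ n)) :
    ∃ (φ' : Plane → Plane) (s : ℕ → ℕ), StrictMono s ∧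
      ∀ x, Tendsto (fun n => φ (s n) x) atTop (𝓝 (φ' x)) := by
  let F : ℕ → BoundedContinuousFunction unitSquare Plane := fun n =>
    BoundedContinuousFunction.mkOfCompact
      ⟨fun x => φ n x, (hφ n).lipschitzWith.continuous.comp continuous_subtype_val⟩
  have hc : IsCompact (closure (range F)) := by
    refine BoundedContinuousFunction.arzela_ascoli (Metric.closedBall 0 (L * 2))
      (isCompact_closedBall _ _) _ ?_ ?_
    · rintro _ x ⟨n, rfl⟩
      simpa [F] using (hφ n).norm_le x
    · refine LipschitzWith.uniformEquicontinuous _ L ?_ |>.equicontinuous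
      rintro ⟨_, n, rfl⟩
      exact ((hφ n).lipschitzWith.comp (LipschitzWith.subtype_val _)).weaken (by simp)
  obtain ⟨f, -, s, hs, hf⟩ := hc.isSeqCompact fun n => subset_closure (mem_range_self n)
  refine ⟨fun x => f ⟨clampSquare x, clampSquare_mem x⟩, s, hs, fun x => ?_⟩
  have h1 := ((continuous_eval_const
    (⟨clampSquare x, clampSquare_mem x⟩ : unitSquare)).tendsto f).comp hf
  refine h1.congr fun n => ?_
  exact (hφ (s n)).map_clamp x

/-- The realizability condition is closed under weak convergence of densities. -/
theorem Realizes.of_tendsto {L : ℝ≥0} {φ : ℕ → Plane → Plane} {ρ : ℕ → Plane → ℝ}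
    {φ' : Plane → Plane} {ρ' : Plane → ℝ} (hφ : ∀ n, Realizes L (φ n) (ρ n))
    (hlim : ∀ x, Tendsto (fun n => φ n x) atTop (𝓝 (φ' x))) (hρc : Continuous ρ')
    (hρ : ∀ η : Plane → ℝ, ContDiff ℝ ∞ η → HasCompactSupport η →
      tsupport η ⊆ interior unitSquare →
      Tendsto (fun n => ∫ x, η x * ρ n x) atTop (𝓝 (∫ x, η x * ρ' x))) :
    Realizes L φ' ρ' := by
  have hdist : ∀ x y, Tendsto (fun n => dist (φ n x) (φ n y)) atTop (𝓝 (dist (φ' x) (φ' y))) :=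
    fun x y => (hlim x).dist (hlim y)
  have hlip : LipschitzWith L φ' := LipschitzWith.of_dist_le_mul fun x y =>
    le_of_tendsto (hdist x y) (.of_forall fun n => (hφ n).lipschitzWith.dist_le_mul x y)
  have hcoord : ∀ i : Fin 2, LipschitzWith L fun x => φ' x i := fun i => by
    simpa [Function.comp_def] using (lipschitzWith_apply i).comp hlip
  have hlimc : ∀ (i : Fin 2) x, Tendsto (fun n => φ n x i) atTop (𝓝 (φ' x i)) := fun i x =>
    ((lipschitzWith_apply i).continuous.tendsto _).comp (hlim x)
  refine ⟨fun x hx y hy => ⟨?_, ?_⟩, fun x => ?_, ?_, ?_⟩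
  · exact ge_of_tendsto (hdist x y) (.of_forall fun n => ((hφ n).biLipschitz x hx y hy).1)
  · exact hlip.dist_le_mul x y
  · exact tendsto_nhds_unique (hlim _) ((hlim x).congr fun n => ((hφ n).map_clamp x).symm)
  · exact tendsto_nhds_unique (hlim 0) (tendsto_const_nhds.congr fun n => (hφ n).map_zero.symm)
  · have hm : LocallyIntegrable fun x => jacobian (fun y => φ' y 0) (fun y => φ' y 1) x - ρ' x := by
      refine LocallyIntegrable.sub ?_ hρc.locallyIntegrable
      have : ∀ (a b : Plane), LocallyIntegrable fun x =>
          lineDeriv ℝ (fun y => φ' y 0) x a * lineDeriv ℝ (fun y => φ' y 1) x b := by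
        intro a b
        refine MemLp.locallyIntegrable (p := ⊤) ?_ le_top
        exact ((hcoord 1).memLp_lineDeriv (μ := volume) b).mul ((hcoord 0).memLp_lineDeriv a)
      exact (this _ _).sub (this _ _)
    -- Fundamental lemma of the calculus of variations: equality against all test functions gives
    -- equality almost everywhere.
    have key := isOpen_interior (s := unitSquare) |>.ae_eq_zero_of_integral_contDiff_smul_eq_zero
      (hm.locallyIntegrableOn _) fun η hη hc hs => ?_
    · filter_upwards [key] with x hx hxi using sub_eq_zero.1 (hx hxi)
    · have hηi : Integrable η := hη.continuous.integrable_of_hasCompactSupport hc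
      have h1 := tendsto_integral_mul_jacobian hη hc (fun n => (hφ n).lipschitzWith_coord 0)
        (hcoord 0) (fun n => (hφ n).lipschitzWith_coord 1) (hcoord 1)
        (fun n => (hφ n).abs_coord_le 0) (fun n => (hφ n).abs_coord_le 1) (hlimc 0) (hlimc 1)
      have hρi : Integrable fun x => η x * ρ' x :=
        (hη.continuous.mul hρc).integrable_of_hasCompactSupport hc.mul_right
      have h2 := tendsto_nhds_unique (h1.congr fun n => (hφ n).integral_eq hs) (hρ η hη hc hs)
      simp only [smul_eq_mul, mul_sub]
      rw [integral_sub (integrable_mul_jacobian hηi (hcoord 0) (hcoord 1)) hρi, h2, sub_self]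

theorem isOpen_nonRealizable (L : ℝ≥0) : IsOpen (nonRealizable L) := by
  rw [← isClosed_compl_iff]
  refine IsSeqClosed.isClosed fun ρ ρ' hρ hlim => ?_
  let E : PosDensity → Plane → ℝ := fun r x => r.1 ⟨clampSquare x, clampSquare_mem x⟩
  have hE : ∀ r x (hx : x ∈ unitSquare), E r x = r.1 ⟨x, hx⟩ := fun r x hx => by
    simp only [E, clampSquare_of_mem hx]
  have hEc : ∀ r, Continuous (E r) := fun r =>
    r.1.continuous.comp (lipschitzWith_clampSquare.continuous.subtype_mk _)
  have hmem : ∀ r, r ∈ (nonRealizable L)ᶜ ↔ ∃ φ, Realizes L φ (E r) := fun r => by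
    rw [← exists_realizes_iff (hE r)]
    simp [nonRealizable]
  simp only [hmem] at hρ ⊢
  choose φ hφ using hρ
  obtain ⟨φ', s, hs, hφ'⟩ := exists_subseq_tendsto hφ
  refine ⟨φ', Realizes.of_tendsto (fun n => hφ (s n)) hφ' (hEc ρ') fun η hη hc hsupp => ?_⟩
  have hpt : ∀ x, Tendsto (fun n => E (ρ (s n)) x) atTop (𝓝 (E ρ' x)) := fun x =>
    ((continuous_eval_const _).comp continuous_subtype_val).tendsto ρ' |>.comp
      (hlim.comp hs.tendsto_atTop)
  obtain ⟨M, hM⟩ := (Metric.isBounded_range_of_tendsto _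
    ((continuous_subtype_val.tendsto ρ').comp hlim)).exists_norm_le
  refine tendsto_integral_mul_of_pointwise (M := M)
    (hη.continuous.integrable_of_hasCompactSupport hc) (fun n => hEc _) (fun n x => ?_) hpt
  exact ((ρ (s n)).1.norm_coe_le_norm _).trans (hM _ (mem_range_self (s n)))

/-! ### Weak mean value inequality and the Riemann–Lebesgue lemma. -/

/-- Mean value inequality in weak form: if a Lipschitz function increases along a segment at average
rate greater than `s`, then some nonnegative test function supported near the segment detects a
directional derivative greater than `s`. -/
theorem LipschitzWith.exists_bump_lt_integral_lineDeriv {f : Plane → ℝ} {C : ℝ≥0}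
    (hf : LipschitzWith C f) {V : Set Plane} (hV : IsOpen V) {x a : Plane} {s t : ℝ} (ht : 0 ≤ t)
    (hseg : ∀ τ ∈ Icc 0 t, x + τ • a ∈ V) (hlt : s * t < f (x + t • a) - f x) :
    ∃ ψ : Plane → ℝ, ContDiff ℝ ∞ ψ ∧ HasCompactSupport ψ ∧ tsupport ψ ⊆ V ∧ (∀ y, 0 ≤ ψ y) ∧
      0 < ∫ y, ψ y ∧ s * ∫ y, ψ y < ∫ y, ψ y * lineDeriv ℝ f y a := by
  by_contra! hcon
  have hK : IsCompact ((fun τ : ℝ => x + τ • a) '' Icc 0 t) :=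
    isCompact_Icc.image (by fun_prop)
  obtain ⟨δ, hδ, hδV⟩ := hK.exists_cthickening_subset_open hV (by rintro _ ⟨τ, hτ, rfl⟩; exact hseg τ hτ)
  -- The margin `s' > s * t` survives when the segment is translated slightly, so it can be averaged
  -- against a bump `b` around `x`.
  obtain ⟨s', hs1, hs2⟩ := exists_between hlt
  have hfc := hf.continuous
  have hev : ∀ᶠ y in 𝓝 x, s' < f (y + t • a) - f y := by
    have : Continuous fun y => f (y + t • a) - f y := by fun_prop
    exact this.continuousAt.eventually_const_lt hs2
  obtain ⟨r, hr, hrV⟩ := Metric.eventually_nhds_iff.1 hev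
  let b : ContDiffBump x := ⟨min δ r / 2, min δ r, by positivity, half_lt_self (by positivity)⟩
  have hbi : Integrable b := b.integrable
  have hbpos : 0 < ∫ y, b y := b.integral_pos
  -- The assumption for contradiction is applied to the bump translated along the segment. It bounds
  -- the derivative in `τ` of `∫ b y * f (y + τ • a)`, and the ordinary mean value inequality
  -- concludes.
  have hbt : ∀ τ ∈ Icc 0 t, ∫ y, b y * lineDeriv ℝ f (y + τ • a) a ≤ s * ∫ y, b y := by
    intro τ hτ
    have h1 := hcon (fun y => b (y - τ • a)) (b.contDiff.comp (contDiff_id.sub contDiff_const))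
      (b.hasCompactSupport.comp_homeomorph (Homeomorph.subRight (τ • a))) ?_
      (fun y => b.nonneg) ?_
    · rw [integral_sub_right_eq_self (fun y => b y)] at h1
      rw [← integral_sub_right_eq_self _ (τ • a)]
      simpa using h1
    · intro y hy
      have h2 : y - τ • a ∈ tsupport b :=
        tsupport_comp_subset_preimage b (f := fun y : Plane => y - τ • a) (by fun_prop) hy
      rw [b.tsupport_eq, Metric.mem_closedBall] at h2
      refine hδV (Metric.mem_cthickening_of_dist_le y (x + τ • a) _ _ ⟨τ, hτ, rfl⟩ ?_)
      refine le_trans ?_ (h2.trans (min_le_left _ _))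
      rw [dist_eq_norm, dist_eq_norm]
      exact le_of_eq (by congr 1; abel)
    · rw [integral_sub_right_eq_self (fun y => b y)]
      exact hbpos
  have hint : ∀ τ : ℝ, Integrable fun y => b y * f (y + τ • a) := fun τ =>
    (b.continuous.mul (by fun_prop : Continuous fun y => f (y + τ • a))).integrable_of_hasCompactSupport
      b.hasCompactSupport.mul_right
  have hder : ∀ τ₀ : ℝ, HasDerivAt (fun τ : ℝ => ∫ y, b y * f (y + τ • a))
      (∫ y, b y * lineDeriv ℝ f (y + τ₀ • a) a) τ₀ := by
    intro τ₀
    refine (hasDerivAt_integral_of_dominated_loc_of_lip (s := univ)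
      (bound := fun y => b y * (C * ‖a‖)) univ_mem
      (.of_forall fun τ => (hint τ).aestronglyMeasurable) (hint τ₀) ?_ (.of_forall fun y => ?_)
      (hbi.mul_const _) ?_).2
    · refine hbi.aestronglyMeasurable.mul ?_
      exact ((measurable_lineDeriv hfc).comp (measurable_add_const _)).aestronglyMeasurable
    · refine LipschitzWith.lipschitzOnWith (LipschitzWith.of_dist_le_mul fun τ τ' => ?_)
      rw [Real.coe_nnabs, abs_of_nonneg (by have := b.nonneg (x := y); positivity), Real.dist_eq,
        ← mul_sub, abs_mul, abs_of_nonneg b.nonneg, mul_assoc]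
      refine mul_le_mul_of_nonneg_left ?_ b.nonneg
      refine (hf.dist_le_mul (y + τ • a) (y + τ' • a)).trans (le_of_eq ?_)
      rw [dist_add_left, dist_eq_norm, ← sub_smul, norm_smul, Real.dist_eq, Real.norm_eq_abs]
      ring
    · have h1 := (measurePreserving_add_right volume (τ₀ • a)).quasiMeasurePreserving.ae
        (hf.ae_differentiableAt (μ := volume))
      filter_upwards [h1] with y hy
      have h2 : HasDerivAt (fun τ : ℝ => y + τ • a) a τ₀ := by
        simpa using ((hasDerivAt_id τ₀).smul_const a).const_add y
      have h3 := hy.hasFDerivAt.comp_hasDerivAt τ₀ h2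
      rw [hy.lineDeriv_eq_fderiv]
      exact h3.const_mul (b y)
  have hmv := (convex_Icc (0 : ℝ) t).image_sub_le_mul_sub_of_deriv_le
    (f := fun τ : ℝ => ∫ y, b y * f (y + τ • a)) (C := s * ∫ y, b y)
    (fun τ _ => (hder τ).continuousAt.continuousWithinAt)
    (fun τ _ => (hder τ).differentiableAt.differentiableWithinAt)
    (fun τ hτ => by rw [(hder τ).deriv]; exact hbt τ (interior_subset hτ))
    0 ⟨le_rfl, ht⟩ t ⟨ht, le_rfl⟩ ht
  rw [← integral_sub (hint t) (hint 0)] at hmv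
  have hge : ∫ y, b y * s' ≤ ∫ y, (b y * f (y + t • a) - b y * f (y + (0 : ℝ) • a)) := by
    refine integral_mono (hbi.mul_const _) ((hint t).sub (hint 0)) fun y => ?_
    simp only [zero_smul, add_zero]
    rw [← mul_sub]
    by_cases hy : dist y x < min δ r
    · exact mul_le_mul_of_nonneg_left (hrV (hy.trans_le (min_le_right _ _))).le b.nonneg
    · rw [b.zero_of_le_dist (not_lt.1 hy)]; simp
  rw [integral_mul_const] at hge
  have := hge.trans hmv
  nlinarith

theorem tendsto_integral_mul_cos {h : Plane → ℝ} (hh : Integrable h) :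
    Tendsto (fun n : ℕ => ∫ x, h x * Real.cos (2 * Real.pi * n * x 0)) atTop (𝓝 0) := by
  have h1 := tendsto_integral_exp_inner_smul_cocompact (V := Plane) (fun x => (h x : ℂ))
  have h2 : Tendsto (fun n : ℕ => (n : ℝ) • (EuclideanSpace.single 0 1 : Plane)) atTop
      (cocompact Plane) := by
    rw [← Metric.cobounded_eq_cocompact, ← comap_norm_atTop, tendsto_comap_iff]
    simpa [Function.comp_def, norm_smul] using tendsto_natCast_atTop_atTop (R := ℝ)
  have h3 := (Complex.continuous_re.tendsto _).comp (h1.comp h2)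
  refine h3.congr fun n => ?_
  have hi : Integrable fun v : Plane => Real.fourierChar
      (-inner ℝ v ((n : ℝ) • (EuclideanSpace.single 0 1 : Plane))) • (h v : ℂ) := 
    (Real.fourierIntegral_convergent_iff _).2 hh.ofReal
  simp only [Function.comp_apply]
  rw [← Complex.reCLM_apply, ← Complex.reCLM.integral_comp_comm hi]
  congr 1
  ext x
  simp [Circle.smul_def, Real.fourierChar_apply, inner_smul_right, EuclideanSpace.inner_single_right]
  have e : -(2 * (Real.pi : ℂ) * (n * (x 0 : ℂ)) * Complex.I)
      = ((-(2 * Real.pi * n * x 0) : ℝ) : ℂ) * Complex.I := by push_cast; ring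
  rw [e, Complex.exp_ofReal_mul_I_re, Real.cos_neg, mul_comm]

/-! ### Horizontal stretch and the Jacobian. -/

/-- `φ` stretches horizontal segments of `W` by a factor at most `s`. -/
def HorizontalBound (W : Set Plane) (φ : Plane → Plane) (s : ℝ) : Prop :=
  ∀ x ∈ W, ∀ t : ℝ, 0 < t → x + t • EuclideanSpace.single 0 1 ∈ W →
    ‖φ (x + t • EuclideanSpace.single 0 1) - φ x‖ ≤ s * t

theorem HorizontalBound.mono {W W' : Set Plane} {φ : Plane → Plane} {s : ℝ}
    (h : HorizontalBound W φ s) (hW : W' ⊆ W) : HorizontalBound W' φ s :=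
  fun x hx t ht hxt => h x (hW hx) t ht (hW hxt)

theorem HorizontalBound.of_tendsto {W : Set Plane} {φ : ℕ → Plane → Plane} {φ' : Plane → Plane}
    {s : ℝ} (h : ∀ᶠ n in atTop, HorizontalBound W (φ n) s)
    (hlim : ∀ x, Tendsto (fun n => φ n x) atTop (𝓝 (φ' x))) : HorizontalBound W φ' s :=
  fun x hx t ht hxt => le_of_tendsto ((hlim _).sub (hlim _)).norm
    (h.mono fun _ hn => hn x hx t ht hxt)

theorem eventually_add_smul_mem {W : Set Plane} (hW : IsOpen W) {x : Plane} (hx : x ∈ W)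
    (a : Plane) : ∀ᶠ t : ℝ in 𝓝 0, x + t • a ∈ W := by
  have h : ContinuousAt (fun t : ℝ => x + t • a) 0 := by fun_prop
  exact h.eventually_mem (by simpa using hW.mem_nhds hx)

theorem HorizontalBound.nonneg {W : Set Plane} (hW : IsOpen W) (hne : W.Nonempty)
    {φ : Plane → Plane} {s : ℝ} (h : HorizontalBound W φ s) : 0 ≤ s := by
  obtain ⟨x, hx⟩ := hne
  obtain ⟨t, ht1, ht0⟩ := (((eventually_add_smul_mem hW hx _).filter_mono
    nhdsWithin_le_nhds).and (self_mem_nhdsWithin (s := Ioi (0 : ℝ)))).exists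
  exact nonneg_of_mul_nonneg_left ((norm_nonneg _).trans (h x hx t ht0 ht1)) ht0

theorem HorizontalBound.norm_fderiv_le {W : Set Plane} (hW : IsOpen W) {φ : Plane → Plane} {s : ℝ}
    (h : HorizontalBound W φ s) {x : Plane} (hx : x ∈ W) (hd : DifferentiableAt ℝ φ x) :
    ‖fderiv ℝ φ x (EuclideanSpace.single 0 1)‖ ≤ s := by
  refine HasDerivAt.le_of_lip' (hd.hasFDerivAt.hasLineDerivAt (EuclideanSpace.single 0 1))
    (h.nonneg hW ⟨x, hx⟩) ?_
  filter_upwards [eventually_add_smul_mem hW hx (EuclideanSpace.single 0 1)] with t ht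
  simp only [zero_smul, add_zero, sub_zero, Real.norm_eq_abs t]
  rcases lt_trichotomy t 0 with h0 | rfl | h0
  · have := h _ ht (-t) (neg_pos.2 h0) (by simpa using hx)
    rw [abs_of_neg h0, norm_sub_rev]
    simpa using this
  · simp
  · rw [abs_of_pos h0]
    exact h x hx t h0 ht

/-- With `a`, `b` the columns of the derivative and `e = (p, q)`, the left side is `g` times `(a - S
e) × b`. Since `|a|` and `|S e|` are at most `|S|`, `|a - S e|² ≤ 2 (S² - S a·e)`. The AM–GM
inequality with parameter `κ` replaces the square root by a bound affine in `a`, which can be passed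
to weak limits. -/
theorem abs_cross_le {a₀ a₁ b₀ b₁ Λ S p q κ g : ℝ} (hκ : 0 < κ) (hΛ : 0 ≤ Λ)
    (ha : a₀ ^ 2 + a₁ ^ 2 ≤ S ^ 2) (hb : b₀ ^ 2 + b₁ ^ 2 ≤ Λ ^ 2) (hpq : p ^ 2 + q ^ 2 ≤ 1)
    (hg : |g| ≤ 1) :
    g * ((a₀ * b₁ - b₀ * a₁) - S * (p * b₁ - q * b₀))
      ≤ Λ * (κ / 2 + (S ^ 2 - S * (p * a₀ + q * a₁)) / κ) := by
  set X := (a₀ - S * p) * b₁ - (a₁ - S * q) * b₀ with hX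
  set m := (a₀ - S * p) ^ 2 + (a₁ - S * q) ^ 2 with hm
  have h1 : (a₀ * b₁ - b₀ * a₁) - S * (p * b₁ - q * b₀) = X := by rw [hX]; ring
  have hm0 : 0 ≤ m := by positivity
  have h2 : X ^ 2 ≤ m * (b₀ ^ 2 + b₁ ^ 2) := by
    rw [hX, hm]; nlinarith [sq_nonneg ((a₀ - S * p) * b₀ + (a₁ - S * q) * b₁)]
  have h3 : m ≤ 2 * (S ^ 2 - S * (p * a₀ + q * a₁)) := by
    have : S ^ 2 * (p ^ 2 + q ^ 2) ≤ S ^ 2 * 1 := mul_le_mul_of_nonneg_left hpq (sq_nonneg S)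
    rw [hm]; nlinarith
  have h4 : |X| ≤ Λ * (κ / 2 + m / (2 * κ)) := by
    refine abs_le_of_sq_le_sq (h2.trans ?_) (by positivity)
    calc m * (b₀ ^ 2 + b₁ ^ 2) ≤ m * Λ ^ 2 := mul_le_mul_of_nonneg_left hb hm0
      _ ≤ Λ ^ 2 * (κ / 2 + m / (2 * κ)) ^ 2 := by
        rw [mul_comm]
        refine mul_le_mul_of_nonneg_left ?_ (sq_nonneg _)
        have : (κ / 2 + m / (2 * κ)) ^ 2 - m = (κ / 2 - m / (2 * κ)) ^ 2 := by
          field_simp; ring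
        nlinarith [sq_nonneg (κ / 2 - m / (2 * κ))]
      _ = _ := by ring
  rw [h1]
  calc g * X ≤ |g| * |X| := by rw [← abs_mul]; exact le_abs_self _
    _ ≤ 1 * |X| := mul_le_mul_of_nonneg_right hg (abs_nonneg _)
    _ ≤ Λ * (κ / 2 + m / (2 * κ)) := by rw [one_mul]; exact h4
    _ ≤ _ := by
      refine mul_le_mul_of_nonneg_left (add_le_add_right ?_ _) hΛ
      rw [div_le_div_iff₀ (by positivity) hκ]
      nlinarith

/-- This is `abs_cross_le` integrated against `ψ`; `g` will be the oscillating factor that detects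
the oscillation of the density. -/
theorem Realizes.jacobian_bound {L : ℝ≥0} {φ : Plane → Plane} {ρ : Plane → ℝ}
    (h : Realizes L φ ρ) {S p q κ : ℝ} (hκ : 0 < κ) (hpq : p ^ 2 + q ^ 2 ≤ 1)
    (hS : HorizontalBound (interior unitSquare) φ S) {ψ g : Plane → ℝ} (hψ : Integrable ψ)
    (hψ0 : ∀ x, 0 ≤ ψ x) (hsupp : tsupport ψ ⊆ interior unitSquare) (hgc : Continuous g)
    (hg : ∀ x, |g x| ≤ 1) :
    (∫ x, ψ x * (g x * ρ x)) -
        S * ((p * ∫ x, ψ x * g x * lineDeriv ℝ (fun y => φ y 1) x (EuclideanSpace.single 1 1))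
          - q * ∫ x, ψ x * g x * lineDeriv ℝ (fun y => φ y 0) x (EuclideanSpace.single 1 1))
      ≤ L * ((κ / 2 + S ^ 2 / κ) * (∫ x, ψ x) - S / κ *
        (p * (∫ x, ψ x * lineDeriv ℝ (fun y => φ y 0) x (EuclideanSpace.single 0 1)) +
          q * ∫ x, ψ x * lineDeriv ℝ (fun y => φ y 1) x (EuclideanSpace.single 0 1))) := by
  have hψg : Integrable fun x => ψ x * g x :=
    hψ.mul_bdd (c := 1) hgc.aestronglyMeasurable (.of_forall hg)
  have i1 := fun (i : Fin 2) (a : Plane) =>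
    LipschitzWith.integrable_mul_lineDeriv hψg (h.lipschitzWith_coord i) a
  have i2 := fun (i : Fin 2) (a : Plane) =>
    LipschitzWith.integrable_mul_lineDeriv hψ (h.lipschitzWith_coord i) a
  have i3 := integrable_mul_jacobian hψg (h.lipschitzWith_coord 0) (h.lipschitzWith_coord 1)
  have e1 : ∫ x, ψ x * (g x * ρ x)
      = ∫ x, ψ x * g x * jacobian (fun y => φ y 0) (fun y => φ y 1) x := by
    rw [h.integral_eq (η := fun x => ψ x * g x) ((tsupport_mul_subset_left).trans hsupp)]
    simp only [mul_assoc]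
  rw [e1]
  set J := jacobian (fun y => φ y 0) (fun y => φ y 1) with hJ
  set U₀ := fun x => lineDeriv ℝ (fun y => φ y 0) x (EuclideanSpace.single 0 1) with hU₀
  set U₁ := fun x => lineDeriv ℝ (fun y => φ y 0) x (EuclideanSpace.single 1 1) with hU₁
  set V₀ := fun x => lineDeriv ℝ (fun y => φ y 1) x (EuclideanSpace.single 0 1) with hV₀
  set V₁ := fun x => lineDeriv ℝ (fun y => φ y 1) x (EuclideanSpace.single 1 1) with hV₁
  have j1 : Integrable fun x => p * (ψ x * g x * V₁ x) := (i1 1 _).const_mul p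
  have j2 : Integrable fun x => q * (ψ x * g x * U₁ x) := (i1 0 _).const_mul q
  have j3 : Integrable fun x => S * (p * (ψ x * g x * V₁ x) - q * (ψ x * g x * U₁ x)) :=
    (j1.sub j2).const_mul S
  have k1 : Integrable fun x => p * (ψ x * U₀ x) := (i2 0 _).const_mul p
  have k2 : Integrable fun x => q * (ψ x * V₀ x) := (i2 1 _).const_mul q
  have k3 : Integrable fun x => S / κ * (p * (ψ x * U₀ x) + q * (ψ x * V₀ x)) :=
    (k1.add k2).const_mul _
  have k4 : Integrable fun x => (κ / 2 + S ^ 2 / κ) * ψ x := hψ.const_mul _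
  have k5 : Integrable fun x => L * ((κ / 2 + S ^ 2 / κ) * ψ x -
      S / κ * (p * (ψ x * U₀ x) + q * (ψ x * V₀ x))) := (k4.sub k3).const_mul _
  have eL : (∫ x, ψ x * g x * J x) -
      S * ((p * ∫ x, ψ x * g x * V₁ x) - q * ∫ x, ψ x * g x * U₁ x)
      = ∫ x, (ψ x * g x * J x - S * (p * (ψ x * g x * V₁ x) - q * (ψ x * g x * U₁ x))) := by
    rw [integral_sub i3 j3, integral_const_mul, integral_sub j1 j2, integral_const_mul,
      integral_const_mul]
  have eR : L * ((κ / 2 + S ^ 2 / κ) * (∫ x, ψ x) - S / κ *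
      (p * (∫ x, ψ x * U₀ x) + q * ∫ x, ψ x * V₀ x))
      = ∫ x, L * ((κ / 2 + S ^ 2 / κ) * ψ x -
        S / κ * (p * (ψ x * U₀ x) + q * (ψ x * V₀ x))) := by
    rw [integral_const_mul, integral_sub k4 k3, integral_const_mul, integral_const_mul,
      integral_add k1 k2, integral_const_mul, integral_const_mul]
  refine eL.trans_le (le_trans ?_ eR.symm.le)
  refine integral_mono_ae (i3.sub j3) k5 ?_
  filter_upwards [h.lipschitzWith.ae_differentiableAt (μ := volume)] with x hx
  by_cases hxi : x ∈ interior unitSquare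
  swap
  · simp [image_eq_zero_of_notMem_tsupport fun h' => hxi (hsupp h')]
  have hbd := hx.hasFDerivAt.le_of_lipschitz h.lipschitzWith
  have ha := hS.norm_fderiv_le isOpen_interior hxi hx
  have hb : ‖fderiv ℝ φ x (EuclideanSpace.single 1 1)‖ ≤ L := by
    simpa using (fderiv ℝ φ x).le_of_opNorm_le hbd (EuclideanSpace.single 1 1)
  have hsq : ∀ v : Plane, v 0 ^ 2 + v 1 ^ 2 = ‖v‖ ^ 2 := fun v => by
    simp [EuclideanSpace.norm_sq_eq, Fin.sum_univ_two]
  have key := abs_cross_le (a₀ := fderiv ℝ φ x (EuclideanSpace.single 0 1) 0)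
    (a₁ := fderiv ℝ φ x (EuclideanSpace.single 0 1) 1)
    (b₀ := fderiv ℝ φ x (EuclideanSpace.single 1 1) 0)
    (b₁ := fderiv ℝ φ x (EuclideanSpace.single 1 1) 1) (S := S) (Λ := L) hκ L.2
    ((hsq _).trans_le (pow_le_pow_left₀ (norm_nonneg _) ha 2))
    ((hsq _).trans_le (pow_le_pow_left₀ (norm_nonneg _) hb 2)) hpq (hg x)
  have key2 := mul_le_mul_of_nonneg_left key (hψ0 x)
  simp only [hJ, hU₀, hU₁, hV₀, hV₁, jacobian, hx.hasFDerivAt.lineDeriv_apply]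
  refine le_trans (le_of_eq ?_) (key2.trans (le_of_eq ?_))
  · ring
  · ring

/-! ### Oscillating densities. -/

theorem tendsto_integral_mul_cos_comp {h : Plane → ℝ} (hh : Integrable h) {N : ℕ → ℕ}
    (hN : Tendsto N atTop atTop) :
    Tendsto (fun n : ℕ => ∫ x, h x * Real.cos (2 * Real.pi * N n * x 0)) atTop (𝓝 0) :=
  (tendsto_integral_mul_cos hh).comp hN

theorem continuous_cos_coord (r : ℝ) : Continuous fun x : Plane => Real.cos (2 * Real.pi * r * x 0) := by
  fun_prop

/-- Products of oscillations in the first variable with weakly converging derivatives in the second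
variable converge weakly to zero. -/
theorem tendsto_integral_mul_cos_mul_lineDeriv {ψ : Plane → ℝ} (hψ : ContDiff ℝ ∞ ψ)
    (hc : HasCompactSupport ψ) {C : ℝ≥0} {v : ℕ → Plane → ℝ} {v' : Plane → ℝ} {M : ℝ}
    (hvC : ∀ n, LipschitzWith C (v n)) (hv'C : LipschitzWith C v') (hM : ∀ n x, |v n x| ≤ M)
    (hv : ∀ x, Tendsto (fun n => v n x) atTop (𝓝 (v' x))) {N : ℕ → ℕ}
    (hN : Tendsto N atTop atTop) :
    Tendsto (fun n => ∫ x, ψ x * Real.cos (2 * Real.pi * N n * x 0) *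
      lineDeriv ℝ (v n) x (EuclideanSpace.single 1 1)) atTop (𝓝 0) := by
  obtain ⟨cD, A, hA⟩ := hψ.exists_lipschitzWith_lineDeriv hc (EuclideanSpace.single 1 1)
  set D := fun x => lineDeriv ℝ ψ x (EuclideanSpace.single 1 1) with hD
  have hDi : Integrable D := hA.continuous.integrable_of_hasCompactSupport cD
  have hM' : ∀ x, |v' x| ≤ M := fun x => le_of_tendsto (hv x).abs (.of_forall fun n => hM n x)
  -- The cosine is constant in the direction of differentiation, so integration by parts
  -- differentiates only `ψ` and produces no factor `N n`.
  have hparts : ∀ n, ∫ x, ψ x * Real.cos (2 * Real.pi * N n * x 0) *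
      lineDeriv ℝ (v n) x (EuclideanSpace.single 1 1)
        = - ∫ x, D x * Real.cos (2 * Real.pi * N n * x 0) * v n x := by
    intro n
    have hsm : ContDiff ℝ ∞ fun x : Plane => ψ x * Real.cos (2 * Real.pi * N n * x 0) := by
      fun_prop
    have hcs : HasCompactSupport fun x : Plane => ψ x * Real.cos (2 * Real.pi * N n * x 0) :=
      hc.mul_right
    obtain ⟨B, hB⟩ := ContDiff.lipschitzWith_of_hasCompactSupport hcs hsm (by simp)
    rw [hB.integral_mul_lineDeriv_eq hcs (hvC n)]
    congr 2
    ext x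
    simp only [hD, lineDeriv]
    rw [← deriv_mul_const_field]
    simp
  have h1 : Tendsto (fun n => ∫ x, (D x * Real.cos (2 * Real.pi * N n * x 0) * v n x -
      D x * Real.cos (2 * Real.pi * N n * x 0) * v' x)) atTop (𝓝 (∫ _ : Plane, (0 : ℝ))) := by
    refine tendsto_integral_of_dominated_convergence (fun x => ‖D x‖ * (2 * M)) (fun n => ?_)
      (hDi.norm.mul_const _) (fun n => .of_forall fun x => ?_) (.of_forall fun x => ?_)
    · have := (hvC n).continuous
      have := hv'C.continuous
      have := hA.continuous
      exact Continuous.aestronglyMeasurable (by fun_prop)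
    · rw [← mul_sub, norm_mul, norm_mul]
      have h3 : ‖v n x - v' x‖ ≤ 2 * M := by
        have h4 := norm_sub_le (v n x) (v' x)
        have h5 := hM n x
        have h6 := hM' x
        simp only [Real.norm_eq_abs] at *
        linarith
      have h4 : ‖Real.cos (2 * Real.pi * N n * x 0)‖ ≤ 1 := Real.abs_cos_le_one _
      calc _ ≤ ‖D x‖ * 1 * (2 * M) := by gcongr
        _ = _ := by ring
    · have h3 : Tendsto (fun n => ‖D x‖ * |v n x - v' x|) atTop (𝓝 0) := by
        simpa using ((hv x).sub_const (v' x)).abs.const_mul ‖D x‖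
      refine squeeze_zero_norm (fun n => ?_) h3
      have h4 : ‖Real.cos (2 * Real.pi * N n * x 0)‖ ≤ 1 := Real.abs_cos_le_one _
      rw [← mul_sub, norm_mul, norm_mul, Real.norm_eq_abs (v n x - v' x)]
      calc _ ≤ ‖D x‖ * 1 * |v n x - v' x| := by gcongr
        _ = _ := by ring
  have hint : ∀ (n : ℕ) (w : Plane → ℝ), Continuous w → (∀ x, |w x| ≤ M) →
      Integrable fun x => D x * Real.cos (2 * Real.pi * N n * x 0) * w x := fun n w hw hwM =>
    (hDi.mul_bdd (c := 1) (continuous_cos_coord _).aestronglyMeasurable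
      (.of_forall fun x => Real.abs_cos_le_one _)).mul_bdd (c := M) hw.aestronglyMeasurable
      (.of_forall hwM)
  have h2 := tendsto_integral_mul_cos_comp
    (hDi.mul_bdd (c := M) hv'C.continuous.aestronglyMeasurable (.of_forall hM')) hN
  have h3 := (h1.add h2).neg
  simp only [integral_zero, add_zero, neg_zero] at h3
  refine h3.congr fun n => ?_
  rw [hparts, integral_sub (hint n _ (hvC n).continuous (hM n)) (hint n _ hv'C.continuous hM')]
  have e : ∀ x, D x * v' x * Real.cos (2 * Real.pi * N n * x 0)
      = D x * Real.cos (2 * Real.pi * N n * x 0) * v' x := fun x => by ring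
  simp only [e]
  ring

/-- The square of the cosine has mean `1 / 2`; the remaining terms oscillate at frequencies `N n`
and `2 * N n` and vanish by Riemann–Lebesgue. -/
theorem tendsto_integral_mul_cos_mul_add {ψ ρ χ : Plane → ℝ} (hψ : Continuous ψ)
    (hc : HasCompactSupport ψ) (hρ : Continuous ρ) (hχ : Continuous χ) (c : ℝ) {N : ℕ → ℕ}
    (hN : Tendsto N atTop atTop) :
    Tendsto (fun n => ∫ x, ψ x * (Real.cos (2 * Real.pi * N n * x 0) *
      (ρ x + c * χ x * Real.cos (2 * Real.pi * N n * x 0)))) atTop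
      (𝓝 (c / 2 * ∫ x, ψ x * χ x)) := by
  have i1 : Integrable fun x => ψ x * ρ x :=
    (hψ.mul hρ).integrable_of_hasCompactSupport hc.mul_right
  have i2 : Integrable fun x => ψ x * χ x :=
    (hψ.mul hχ).integrable_of_hasCompactSupport hc.mul_right
  have hN2 : Tendsto (fun n => 2 * N n) atTop atTop :=
    tendsto_atTop_mono (fun n => by omega) hN
  have h := ((tendsto_integral_mul_cos_comp i1 hN).const_add (c / 2 * ∫ x, ψ x * χ x)).add
    ((tendsto_integral_mul_cos_comp i2 hN2).const_mul (c / 2))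
  simp only [add_zero, mul_zero] at h
  refine h.congr fun n => ?_
  have k1 : Integrable fun x => ψ x * ρ x * Real.cos (2 * Real.pi * N n * x 0) :=
    i1.mul_bdd (c := 1) (continuous_cos_coord _).aestronglyMeasurable
      (.of_forall fun x => Real.abs_cos_le_one _)
  have k2 : Integrable fun x => c / 2 * (ψ x * χ x *
      Real.cos (2 * Real.pi * (2 * N n : ℕ) * x 0)) :=
    (i2.mul_bdd (c := 1) (continuous_cos_coord _).aestronglyMeasurable
      (.of_forall fun x => Real.abs_cos_le_one _)).const_mul _
  have k3 : Integrable fun x => c / 2 * (ψ x * χ x) := i2.const_mul _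
  have k4 : Integrable fun x => c / 2 * (ψ x * χ x) +
    ψ x * ρ x * Real.cos (2 * Real.pi * N n * x 0) := k3.add k1
  rw [← integral_const_mul, ← integral_const_mul, ← integral_add k3 k1, ← integral_add k4 k2]
  congr 1
  ext x
  have e : 2 * Real.pi * (2 * N n : ℕ) * x 0 = 2 * (2 * Real.pi * N n * x 0) := by
    push_cast; ring
  rw [e, Real.cos_two_mul]
  ring

/-- If maps with horizontal stretch at most `S` realize densities that oscillate with amplitude `c`,
and their limit has horizontal stretch at least `s` in the mean, then `S - s` cannot be small. -/
theorem oscillation_estimate {L : ℝ≥0} {φ : ℕ → Plane → Plane} {φ' : Plane → Plane}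
    {ρ χ ψ : Plane → ℝ} {c S s p q κ : ℝ} {N : ℕ → ℕ} (hc : 0 < c) (hκ : 0 < κ) (hS0 : 0 ≤ S)
    (hN : Tendsto N atTop atTop) (hρ : Continuous ρ) (hχ : Continuous χ)
    (hφ : ∀ n, Realizes L (φ n) fun x => ρ x + c * χ x * Real.cos (2 * Real.pi * N n * x 0))
    (hφ' : ∀ i : Fin 2, LipschitzWith L fun x => φ' x i)
    (hlim : ∀ x, Tendsto (fun n => φ n x) atTop (𝓝 (φ' x)))
    (hS : ∀ n, HorizontalBound (interior unitSquare) (φ n) S)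
    (hψ : ContDiff ℝ ∞ ψ) (hψc : HasCompactSupport ψ) (hψ0 : ∀ x, 0 ≤ ψ x)
    (hsupp : tsupport ψ ⊆ interior unitSquare) (hχψ : ∀ x ∈ tsupport ψ, 1 / 2 ≤ χ x)
    (hpq : p ^ 2 + q ^ 2 ≤ 1)
    (hs : s * ∫ x, ψ x ≤
      p * (∫ x, ψ x * lineDeriv ℝ (fun y => φ' y 0) x (EuclideanSpace.single 0 1)) +
        q * ∫ x, ψ x * lineDeriv ℝ (fun y => φ' y 1) x (EuclideanSpace.single 0 1)) :
    c / 4 * (∫ x, ψ x) ≤ L * (κ / 2 + S * (S - s) / κ) * ∫ x, ψ x := by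
  have hψi : Integrable ψ := hψ.continuous.integrable_of_hasCompactSupport hψc
  obtain ⟨A, hA⟩ := ContDiff.lipschitzWith_of_hasCompactSupport hψc hψ (by simp)
  have hlimc : ∀ (i : Fin 2) x, Tendsto (fun n => φ n x i) atTop (𝓝 (φ' x i)) := fun i x =>
    ((lipschitzWith_apply i).continuous.tendsto _).comp (hlim x)
  have hb := fun n => (hφ n).jacobian_bound hκ hpq (hS n) hψi hψ0 hsupp
    (continuous_cos_coord (N n)) fun x => Real.abs_cos_le_one _
  have t1 := tendsto_integral_mul_cos_mul_add hψ.continuous hψc hρ hχ c hN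
  have t2 := fun i : Fin 2 => tendsto_integral_mul_cos_mul_lineDeriv hψ hψc
    (fun n => (hφ n).lipschitzWith_coord i) (hφ' i) (fun n => (hφ n).abs_coord_le i) (hlimc i) hN
  have t3 := fun i : Fin 2 => tendsto_integral_mul_lineDeriv (μ := volume) hA hψc
    (fun n => (hφ n).lipschitzWith_coord i) (hφ' i) (fun n => (hφ n).abs_coord_le i) (hlimc i)
    (EuclideanSpace.single 0 1)
  -- In the limit the terms with `∂₁φ` drop out, and the horizontal derivatives become those of
  -- `φ'`, controlled from below by `hs`.
  have hle := le_of_tendsto_of_tendsto'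
    (t1.sub ((((t2 1).const_mul p).sub ((t2 0).const_mul q)).const_mul S))
    ((((((t3 0).const_mul p).add ((t3 1).const_mul q)).const_mul (S / κ)).const_sub
      ((κ / 2 + S ^ 2 / κ) * ∫ x, ψ x)).const_mul (L : ℝ)) hb
  simp only [mul_zero, sub_zero] at hle
  have hlow : 1 / 2 * (∫ x, ψ x) ≤ ∫ x, ψ x * χ x := by
    rw [← integral_const_mul]
    refine integral_mono (hψi.const_mul _)
      ((hψ.continuous.mul hχ).integrable_of_hasCompactSupport hψc.mul_right) fun x => ?_
    by_cases hx : x ∈ tsupport ψ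
    · simp only
      rw [mul_comm]
      exact mul_le_mul_of_nonneg_left (hχψ x hx) (hψ0 x)
    · simp [image_eq_zero_of_notMem_tsupport hx]
  calc c / 4 * (∫ x, ψ x) = c / 2 * (1 / 2 * ∫ x, ψ x) := by ring
    _ ≤ c / 2 * ∫ x, ψ x * χ x := by gcongr
    _ ≤ _ := hle
    _ ≤ L * ((κ / 2 + S ^ 2 / κ) * (∫ x, ψ x) - S / κ * (s * ∫ x, ψ x)) := by gcongr
    _ = _ := by ring

/-! ### Horizontal lines and cutoffs around them. -/

theorem interior_unitSquare_nonempty : (interior unitSquare).Nonempty := by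
  refine ⟨WithLp.toLp 2 fun _ => 1 / 2, mem_interior_iff_mem_nhds.2 ?_⟩
  have h : ∀ i : Fin 2, ∀ᶠ x : Plane in 𝓝 (WithLp.toLp 2 fun _ => 1 / 2), x i ∈ Icc (0 : ℝ) 1 :=
    fun i => (lipschitzWith_apply i).continuous.continuousAt.eventually_mem
      (Icc_mem_nhds (by norm_num) (by norm_num))
  exact eventually_all.2 h

theorem measure_horizontal_line (r : ℝ) : volume {x : Plane | x 1 = r} = 0 := by
  have h := (convex_halfSpace_le (𝕜 := ℝ) (f := fun x : Plane => x 1)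
    ⟨fun _ _ => rfl, fun _ _ => rfl⟩ r).addHaar_frontier volume
  refine measure_mono_null (fun x (hx : x 1 = r) => ?_) h
  rw [frontier_eq_closure_inter_closure]
  refine ⟨subset_closure hx.le, mem_closure_of_tendsto (f := fun t : ℝ =>
    x + t • EuclideanSpace.single 1 1) (b := 𝓝[>] 0) ?_ ?_⟩
  · have : ContinuousAt (fun t : ℝ => x + t • (EuclideanSpace.single 1 1 : Plane)) 0 := by fun_prop
    simpa using this.tendsto.mono_left nhdsWithin_le_nhds
  · filter_upwards [self_mem_nhdsWithin] with t ht
    simp only [mem_Ioi] at ht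
    simp [hx, ht]

/-- A stretch bound on a dense set of horizontal lines holds on all of them. -/
theorem HorizontalBound.of_dense {W : Set Plane} (hW : IsOpen W) {D : Set ℝ} (hD : Dense D)
    {φ : Plane → Plane} (hφ : Continuous φ) {s : ℝ}
    (h : HorizontalBound {x ∈ W | x 1 ∈ D} φ s) : HorizontalBound W φ s := by
  intro x hx t ht hxt
  obtain ⟨r, hr, hrt⟩ := mem_closure_iff_seq_limit.1 (hD (x 1))
  let y : ℕ → Plane := fun n => x + (r n - x 1) • EuclideanSpace.single 1 1
  have hy1 : ∀ n, y n 1 = r n := fun n => by simp [y]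
  have hy : Tendsto y atTop (𝓝 x) := by
    have := ((hrt.sub_const (x 1)).smul_const (EuclideanSpace.single 1 1 : Plane)).const_add x
    simpa using this
  have hy' := hy.add_const (t • (EuclideanSpace.single 0 1 : Plane))
  refine le_of_tendsto (((hφ.tendsto _).comp hy').sub ((hφ.tendsto _).comp hy)).norm ?_
  filter_upwards [hy.eventually_mem (hW.mem_nhds hx), hy'.eventually_mem (hW.mem_nhds hxt)]
    with n h1 h2
  exact h (y n) ⟨h1, by simpa [hy1] using hr n⟩ t ht ⟨h2, by simpa [hy1] using hr n⟩

/-- A continuous approximation of the indicator function of finitely many horizontal lines. -/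
noncomputable def lineCutoff (q : ℕ → ℝ) (k j : ℕ) (x : Plane) : ℝ :=
  1 / (1 + j * ∏ i ∈ Finset.range k, (x 1 - q i) ^ 2)

section lineCutoff

variable (q : ℕ → ℝ) (k j : ℕ) (x : Plane)

theorem one_le_lineCutoff_denom :
    1 ≤ 1 + (j : ℝ) * ∏ i ∈ Finset.range k, (x 1 - q i) ^ 2 := by
  have : 0 ≤ ∏ i ∈ Finset.range k, (x 1 - q i) ^ 2 := Finset.prod_nonneg fun _ _ => sq_nonneg _
  have := mul_nonneg (Nat.cast_nonneg j : (0 : ℝ) ≤ j) this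
  linarith

theorem lineCutoff_nonneg : 0 ≤ lineCutoff q k j x :=
  div_nonneg zero_le_one (zero_le_one.trans (one_le_lineCutoff_denom q k j x))

theorem lineCutoff_le_one : lineCutoff q k j x ≤ 1 :=
  div_le_one_of_le₀ (one_le_lineCutoff_denom q k j x)
    (zero_le_one.trans (one_le_lineCutoff_denom q k j x))

theorem continuous_lineCutoff : Continuous (lineCutoff q k j) :=
  continuous_const.div (by fun_prop) fun x => by
    have := one_le_lineCutoff_denom q k j x
    positivity

variable {q k x} in
theorem lineCutoff_eq_one {i : ℕ} (hi : i < k) (hx : x 1 = q i) : lineCutoff q k j x = 1 := by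
  have : ∏ i ∈ Finset.range k, (x 1 - q i) ^ 2 = 0 :=
    Finset.prod_eq_zero (Finset.mem_range.2 hi) (by rw [hx, sub_self]; norm_num)
  simp [lineCutoff, this]

theorem ae_tendsto_lineCutoff :
    ∀ᵐ x : Plane, Tendsto (fun j => lineCutoff q k j x) atTop (𝓝 0) := by
  have h : ∀ᵐ x : Plane, ∀ i, x 1 ≠ q i := ae_all_iff.2 fun i =>
    measure_eq_zero_iff_ae_notMem.1 (measure_horizontal_line (q i))
  filter_upwards [h] with x hx
  have hpos : 0 < ∏ i ∈ Finset.range k, (x 1 - q i) ^ 2 :=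
    Finset.prod_pos fun i _ => by have := sub_ne_zero.2 (hx i); positivity
  simp only [lineCutoff, one_div]
  exact (tendsto_atTop_add_const_left _ _
    (tendsto_natCast_atTop_atTop.atTop_mul_const hpos)).inv_tendsto_atTop

end lineCutoff

/-! ### Density of the non-realizable densities. -/

/-- Near any continuous density there is one that is not the Jacobian of an `L`-bi-Lipschitz map. -/
theorem exists_not_realizes (L : ℝ≥0) {ρ₀ : Plane → ℝ} (hρ₀ : Continuous ρ₀) {c : ℝ} (hc : 0 < c) :
    ∃ ρ : Plane → ℝ, Continuous ρ ∧ (∀ x, |ρ x - ρ₀ x| ≤ c) ∧ ¬ ∃ φ, Realizes L φ ρ := by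
  by_contra! H
  let W := interior unitSquare
  have hW : IsOpen W := isOpen_interior
  -- The horizontal stretches that some density in the ball forces every realization to exceed. The
  -- value `-1` makes `T` nonempty, and realizability together with the Lipschitz constant `L`
  -- bounds it.
  let T : Set ℝ := {s | ∃ ρ : Plane → ℝ, Continuous ρ ∧ (∀ x, |ρ x - ρ₀ x| ≤ c) ∧
    ∀ φ, Realizes L φ ρ → ¬ HorizontalBound W φ s}
  have hT1 : -1 ∈ T := ⟨ρ₀, hρ₀, fun x => by simpa using hc.le, fun φ _ h => by
    have := h.nonneg hW interior_unitSquare_nonempty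
    linarith⟩
  have hTL : ∀ s ∈ T, s ≤ L := by
    rintro s ⟨ρ, h1, h2, h3⟩
    by_contra! hs
    obtain ⟨φ, hφ⟩ := H ρ h1 h2
    refine h3 φ hφ fun x _ t ht _ => ?_
    have := hφ.lipschitzWith.dist_le_mul (x + t • EuclideanSpace.single 0 1) x
    rw [dist_eq_norm, dist_eq_norm, add_sub_cancel_left, norm_smul] at this
    simp only [Real.norm_eq_abs, abs_of_pos ht, PiLp.norm_single, Real.norm_eq_abs, abs_one, mul_one] at this
    exact this.trans (mul_le_mul_of_nonneg_right hs.le ht.le)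
  have hTb : BddAbove T := ⟨L, hTL⟩
  let Λ : ℝ := L + 1
  have hΛ : 1 ≤ Λ := by simp [Λ]
  -- With `κ = c / (4 * Λ)` below, the error in `oscillation_estimate` is at most `c / 8 + c / 16`,
  -- less than `c / 4`. The `min` with `1` ensures `S ≤ Λ`.
  let δ : ℝ := min 1 (c ^ 2 / (128 * Λ ^ 3))
  have hδ : 0 < δ := by positivity
  obtain ⟨s, hsT, hs⟩ := exists_lt_of_lt_csSup ⟨-1, hT1⟩ (sub_lt_self (sSup T) hδ)
  obtain ⟨ρ, hρ, hρc, hρs⟩ := hsT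
  let S := sSup T + δ
  have hSL : S ≤ Λ := add_le_add (csSup_le ⟨-1, hT1⟩ hTL) (min_le_left _ _)
  have hS : ∀ ρ : Plane → ℝ, Continuous ρ → (∀ x, |ρ x - ρ₀ x| ≤ c) →
      ∃ φ, Realizes L φ ρ ∧ HorizontalBound W φ S := by
    intro r h1 h2
    by_contra! h3
    have : S ≤ sSup T := le_csSup hTb ⟨r, h1, h2, h3⟩
    linarith
  let q := TopologicalSpace.denseSeq ℝ
  let lines : ℕ → Set Plane := fun k => {x ∈ W | ∃ i < k, x 1 = q i}
  let ρm : ℕ → ℕ → Plane → ℝ := fun k j x => ρ x + lineCutoff q k j x * (ρ₀ x - ρ x)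
  have hρm : ∀ k j, Continuous (ρm k j) := fun k j =>
    hρ.add ((continuous_lineCutoff q k j).mul (hρ₀.sub hρ))
  -- making room for oscillations near finitely many lines
  obtain ⟨k, j, hkj⟩ : ∃ k j, ∀ φ, Realizes L φ (ρm k j) → ¬ HorizontalBound (lines k) φ s := by
    -- Otherwise let `j → ∞`: `ρm k j` tends to `ρ` almost everywhere, as lines are null, so `ρ` has
    -- a realization with stretch at most `s` on the first `k` lines. Then `k → ∞` gives one with
    -- this bound on a dense set of lines, hence everywhere, against the choice of `ρ`.
    by_contra! hcon
    choose φ hφ hφb using hcon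
    have hk : ∀ k, ∃ φ', Realizes L φ' ρ ∧ HorizontalBound (lines k) φ' s := by
      intro k
      obtain ⟨φ', n, hn, hlim⟩ := exists_subseq_tendsto (hφ k)
      refine ⟨φ', Realizes.of_tendsto (fun i => hφ k (n i)) hlim hρ fun η hη hηc _ => ?_,
        HorizontalBound.of_tendsto (.of_forall fun i => hφb k (n i)) hlim⟩
      refine tendsto_integral_of_dominated_convergence (fun x => |η x| * (|ρ x| + c))
        (fun i => (hη.continuous.mul (hρm k (n i))).aestronglyMeasurable)
        ((hη.continuous.abs.mul (hρ.abs.add continuous_const)).integrable_of_hasCompactSupport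
          (HasCompactSupport.mul_right (hηc.comp_left abs_zero)))
        (fun i => .of_forall fun x => ?_) ?_
      · rw [norm_mul, Real.norm_eq_abs, Real.norm_eq_abs]
        refine mul_le_mul_of_nonneg_left ((abs_add_le _ _).trans ?_) (abs_nonneg _)
        gcongr
        rw [abs_mul, abs_of_nonneg (lineCutoff_nonneg q k (n i) x), abs_sub_comm]
        exact (mul_le_of_le_one_left (abs_nonneg _) (lineCutoff_le_one q k (n i) x)).trans (hρc x)
      · filter_upwards [ae_tendsto_lineCutoff q k] with x hx
        have := (((hx.comp hn.tendsto_atTop).mul_const (ρ₀ x - ρ x)).const_add (ρ x)).const_mul (η x)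
        simpa using this
    choose φ₁ hφ₁ hφ₁b using hk
    obtain ⟨φ', n, hn, hlim⟩ := exists_subseq_tendsto hφ₁
    have hφ' : Realizes L φ' ρ := Realizes.of_tendsto (fun i => hφ₁ (n i)) hlim hρ
      fun _ _ _ _ => tendsto_const_nhds
    refine hρs φ' hφ' (HorizontalBound.of_dense hW (TopologicalSpace.denseRange_denseSeq ℝ)
      hφ'.lipschitzWith.continuous fun x hx t ht hxt => ?_)
    obtain ⟨hxW, i, hi⟩ := hx
    have hi' : x 1 = q i := hi.symm
    refine HorizontalBound.of_tendsto (W := {x ∈ W | x 1 = q i}) ?_ hlim x ⟨hxW, hi'⟩ t ht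
      ⟨hxt.1, by simpa using hi'⟩
    filter_upwards [eventually_gt_atTop i] with m hm
    exact (hφ₁b (n m)).mono fun y hy => ⟨hy.1, i, hm.trans_le (hn.id_le m), hy.2⟩
  let χ := lineCutoff q k j
  have hχ : Continuous χ := continuous_lineCutoff q k j
  -- densities oscillating around `ρm k j`
  have hosc : ∀ n : ℕ, ∃ φ, Realizes L φ
      (fun x => ρm k j x + c * χ x * Real.cos (2 * Real.pi * n * x 0)) ∧ HorizontalBound W φ S := by
    intro n
    -- Since `ρm k j - ρ₀ = (1 - χ) * (ρ - ρ₀)`, an oscillation of amplitude `c * χ` stays in the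
    -- ball of radius `c`.
    refine hS _ ((hρm k j).add ((continuous_const.mul hχ).mul (continuous_cos_coord n))) fun x => ?_
    have h0 := lineCutoff_nonneg q k j x
    have h1 := lineCutoff_le_one q k j x
    have h2 : |Real.cos (2 * Real.pi * n * x 0)| ≤ 1 := Real.abs_cos_le_one _
    calc |ρm k j x + c * χ x * Real.cos (2 * Real.pi * n * x 0) - ρ₀ x|
        = |(1 - χ x) * (ρ x - ρ₀ x) + c * χ x * Real.cos (2 * Real.pi * n * x 0)| := by
          simp only [ρm, χ]; ring_nf
      _ ≤ (1 - χ x) * |ρ x - ρ₀ x| + c * χ x * |Real.cos (2 * Real.pi * n * x 0)| := by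
          refine (abs_add_le _ _).trans (le_of_eq ?_)
          rw [abs_mul, abs_mul, abs_of_nonneg (sub_nonneg.2 h1), abs_of_nonneg (mul_nonneg hc.le h0)]
      _ ≤ (1 - χ x) * c + c * χ x * 1 :=
          add_le_add (mul_le_mul_of_nonneg_left (hρc x) (sub_nonneg.2 h1))
            (mul_le_mul_of_nonneg_left h2 (mul_nonneg hc.le h0))
      _ = c := by ring
  choose φ hφ hφS using hosc
  obtain ⟨φ', n, hn, hlim⟩ := exists_subseq_tendsto hφ
  have hφ' : Realizes L φ' (ρm k j) := by
    refine Realizes.of_tendsto (fun i => hφ (n i)) hlim (hρm k j) fun η hη hηc _ => ?_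
    have i1 : Integrable fun x => η x * ρm k j x :=
      (hη.continuous.mul (hρm k j)).integrable_of_hasCompactSupport hηc.mul_right
    have i2 : Integrable fun x => c * (η x * χ x) :=
      ((hη.continuous.mul hχ).integrable_of_hasCompactSupport hηc.mul_right).const_mul c
    have h1 := (tendsto_integral_mul_cos_comp i2 hn.tendsto_atTop).const_add
      (∫ x, η x * ρm k j x)
    rw [add_zero] at h1
    refine h1.congr fun i => ?_
    rw [← integral_add i1 (i2.mul_bdd (c := 1) (continuous_cos_coord _).aestronglyMeasurable
      (.of_forall fun x => Real.abs_cos_le_one _))]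
    congr 1
    ext x
    ring
  -- the limit stretches a segment of one of the lines by more than `s`
  obtain ⟨x, ⟨hxW, i, hik, hxi⟩, t, ht, hxt, hlt⟩ : ∃ x ∈ lines k, ∃ t : ℝ, 0 < t ∧
      x + t • EuclideanSpace.single 0 1 ∈ lines k ∧
      s * t < ‖φ' (x + t • EuclideanSpace.single 0 1) - φ' x‖ := by
    have := hkj φ' hφ'
    simpa only [HorizontalBound, not_forall, not_le, exists_prop] using this
  set d := φ' (x + t • EuclideanSpace.single 0 1) - φ' x with hd
  -- The direction in which the segment is stretched; `e = 0` if `d = 0`, so only `‖e‖ ≤ 1` is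
  -- claimed.
  let e : Plane := ‖d‖⁻¹ • d
  have hed : e 0 * d 0 + e 1 * d 1 = ‖d‖ := by
    have h1 : d 0 ^ 2 + d 1 ^ 2 = ‖d‖ ^ 2 := by
      simp [EuclideanSpace.norm_sq_eq, Fin.sum_univ_two]
    have h2 : e 0 * d 0 + e 1 * d 1 = ‖d‖⁻¹ * (d 0 ^ 2 + d 1 ^ 2) := by
      simp only [e, PiLp.smul_apply, smul_eq_mul]; ring
    rw [h2, h1]
    rcases eq_or_ne ‖d‖ 0 with h | h
    · simp [h]
    · field_simp
  have he : e 0 ^ 2 + e 1 ^ 2 ≤ 1 := by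
    have h1 : e 0 ^ 2 + e 1 ^ 2 = ‖e‖ ^ 2 := by
      simp [EuclideanSpace.norm_sq_eq, Fin.sum_univ_two]
    rw [h1, norm_smul, norm_inv, norm_norm]
    exact pow_le_one₀ (by positivity) (inv_mul_le_one)
  have hf0 := hφ'.lipschitzWith_coord 0
  have hf1 := hφ'.lipschitzWith_coord 1
  have hf0' : LipschitzWith (‖e 0‖₊ * L) fun y => e 0 * φ' y 0 := by
    simpa [Function.comp_def] using (lipschitzWith_smul (e 0)).comp hf0
  have hf1' : LipschitzWith (‖e 1‖₊ * L) fun y => e 1 * φ' y 1 := by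
    simpa [Function.comp_def] using (lipschitzWith_smul (e 1)).comp hf1
  -- The interior of the square is convex, and `χ = 1` on the whole line.
  have hseg : ∀ τ ∈ Icc 0 t, x + τ • EuclideanSpace.single 0 1 ∈ {y ∈ W | 1 / 2 < χ y} := by
    refine fun τ hτ => ⟨?_, ?_⟩
    · have hmem := convex_unitSquare.interior.add_smul_sub_mem hxW hxt.1
        (t := τ / t) ⟨div_nonneg hτ.1 ht.le, div_le_one_of_le₀ hτ.2 ht.le⟩
      rw [add_sub_cancel_left, smul_smul, div_mul_cancel₀ _ ht.ne'] at hmem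
      exact hmem
    · have : χ (x + τ • EuclideanSpace.single 0 1) = 1 :=
        lineCutoff_eq_one j hik (by simpa using hxi)
      rw [this]
      norm_num
  have hinc : s * t < (e 0 * φ' (x + t • EuclideanSpace.single 0 1) 0 +
      e 1 * φ' (x + t • EuclideanSpace.single 0 1) 1) - (e 0 * φ' x 0 + e 1 * φ' x 1) := by
    refine hlt.trans_eq ?_
    rw [← hed, hd]
    simp only [PiLp.sub_apply]
    ring
  obtain ⟨ψ, hψ, hψc, hψV, hψ0, hψpos, hψs⟩ :=
    (hf0'.add hf1').exists_bump_lt_integral_lineDeriv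
      (hW.inter (isOpen_lt continuous_const hχ)) ht.le hseg hinc
  have hψi : Integrable ψ := hψ.continuous.integrable_of_hasCompactSupport hψc
  have hS0 : 0 ≤ S := (hφS 0).nonneg hW interior_unitSquare_nonempty
  have hκ : 0 < c / (4 * Λ) := by positivity
  have est := oscillation_estimate hc hκ hS0 hn.tendsto_atTop (hρm k j) hχ
    (fun i => hφ (n i)) hφ'.lipschitzWith_coord hlim (fun i => hφS (n i)) hψ hψc hψ0
    (fun y hy => (hψV hy).1) (fun y hy => (hψV hy).2.le) he (s := s) ?_
  · have est' := le_of_mul_le_mul_right est hψpos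
    have hSs : S - s ≤ 2 * δ := by simp only [S]; linarith
    have hδc : δ ≤ c ^ 2 / (128 * Λ ^ 3) := min_le_right _ _
    have hLΛ : (L : ℝ) ≤ Λ := by simp [Λ]
    have hb : (L : ℝ) * (c / (4 * Λ) / 2 + S * (S - s) / (c / (4 * Λ)))
        ≤ Λ * (c / (4 * Λ) / 2 + Λ * (2 * (c ^ 2 / (128 * Λ ^ 3))) / (c / (4 * Λ))) := by
      have h1 : S * (S - s) ≤ Λ * (2 * (c ^ 2 / (128 * Λ ^ 3))) :=
        (mul_le_mul_of_nonneg_left (hSs.trans (by linarith)) hS0).trans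
          (mul_le_mul_of_nonneg_right hSL (by positivity))
      refine (mul_le_mul_of_nonneg_left (add_le_add_right ?_ _) L.2).trans
        (mul_le_mul_of_nonneg_right hLΛ (by positivity))
      exact div_le_div_of_nonneg_right h1 hκ.le
    have heq : Λ * (c / (4 * Λ) / 2 + Λ * (2 * (c ^ 2 / (128 * Λ ^ 3))) / (c / (4 * Λ)))
        = 3 / 16 * c := by
      have : Λ ≠ 0 := by positivity
      field_simp
      norm_num
    linarith
  · refine hψs.le.trans (le_of_eq ?_)
    have k0 := (LipschitzWith.integrable_mul_lineDeriv hψi hf0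
      (EuclideanSpace.single 0 1)).const_mul (e 0)
    have k1 := (LipschitzWith.integrable_mul_lineDeriv hψi hf1
      (EuclideanSpace.single 0 1)).const_mul (e 1)
    rw [← integral_const_mul, ← integral_const_mul, ← integral_add k0 k1]
    refine integral_congr_ae ?_
    filter_upwards [hf0.ae_differentiableAt (μ := volume),
      hf1.ae_differentiableAt (μ := volume)] with y h0 h1
    rw [((h0.const_mul (e 0)).fun_add (h1.const_mul (e 1))).lineDeriv_eq_fderiv,
      h0.lineDeriv_eq_fderiv, h1.lineDeriv_eq_fderiv, fderiv_fun_add (h0.const_mul _) (h1.const_mul _),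
      fderiv_const_mul h0, fderiv_const_mul h1]
    simp
    ring

theorem dense_nonRealizable (L : ℝ≥0) : Dense (nonRealizable L) := by
  intro ρ₀
  rw [Metric.mem_closure_iff]
  intro ε hε
  have : Nonempty unitSquare := ⟨⟨0, zero_mem_unitSquare⟩⟩
  obtain ⟨x₀, -, hx₀⟩ := isCompact_univ.exists_isMinOn univ_nonempty ρ₀.1.continuous.continuousOn
  -- Less than the minimum of `ρ₀`, so that the perturbed density stays positive, and less than `ε`.
  let c := min ε (ρ₀.1 x₀) / 2
  have hm : 0 < min ε (ρ₀.1 x₀) := lt_min hε (ρ₀.2 x₀)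
  have hc : 0 < c := half_pos hm
  obtain ⟨ρ, hρ, hρc, hne⟩ := exists_not_realizes L (ρ₀ := fun x => ρ₀.1 ⟨clampSquare x, clampSquare_mem x⟩)
    (ρ₀.1.continuous.comp (lipschitzWith_clampSquare.continuous.subtype_mk _)) hc
  have hρc' : ∀ x : unitSquare, |ρ x - ρ₀.1 x| ≤ c := fun x => by
    simpa only [clampSquare_of_mem x.2] using hρc x
  have hpos : ∀ x : unitSquare, 0 < ρ x := fun x => by
    have h1 := (abs_le.1 (hρc' x)).1
    have h2 : ρ₀.1 x₀ ≤ ρ₀.1 x := hx₀ (mem_univ x)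
    have h3 : c < ρ₀.1 x₀ := (half_lt_self hm).trans_le (min_le_right _ _)
    linarith
  refine ⟨⟨⟨fun x => ρ x, hρ.comp continuous_subtype_val⟩, hpos⟩, ?_, ?_⟩
  · intro h
    exact hne ((exists_realizes_iff fun _ _ => rfl).1 h)
  · rw [Subtype.dist_eq, dist_comm]
    refine ((ContinuousMap.dist_le hc.le).2 fun x => ?_).trans_lt
      ((half_lt_self hm).trans_le (min_le_left _ _))
    exact hρc' x

theorem proposition2 (L : ℝ) (hL : 1 < L) :
    IsOpen (nonRealizable L) ∧ Dense (nonRealizable L) := by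
  lift L to ℝ≥0 using zero_le_one.trans hL.le
  exact ⟨isOpen_nonRealizable L, dense_nonRealizable L⟩
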